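/- Let $\mathbb N=\{1,2,\dots\}$. An infinite binary information system is a pair $U=(A,F)$ with $A$ an infinite set (of objects) and $F$ an infinite set of functions $A\to\{0,1\}$ (attributes). A problem over $U$ of dimension $n\ge 1$ is a tuple $z=(\nu,f_1,\dots,f_n)$ with $\nu:\{0,1\}^n\to\mathbb N$ and $f_1,\dots,f_n\in F$ (not necessarily distinct); put $z(a)=\nu(f_1(a),\dots,f_n(a))$ for $a\in A$. A decision tree over $z$ is a finite directed tree with a root in which the root and the edges leaving it are unlabeled, each terminal node is labeled with a number from $\mathbb N$, each working node (neither the root nor terminal) is labeled with an attribute from $\{f_1,\dots,f_n\}$, and each edge leaving a working node is labeled with $0$ or $1$. A complete path is a directed path $\xi$ from the root to a terminal node, and $A(\xi)$ is the set of $a\in A$ such that, for each working node on $\xi$, its attribute takes at $a$ the value labeling the edge by which $\xi$ leaves it. The tree solves $z$ nondeterministically if each $a\in A$ lies in $A(\xi)$ for some complete path $\xi$ and, whenever $a\in A(\xi)$, the terminal node of $\xi$ is labeled with $z(a)$. It solves $z$ deterministically if, moreover, only one edge leaves the root and the edges leaving any working node have different labels. The depth of a tree is the maximum number of working nodes on a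 complete path. Let $h^{ld}_U(n)$, $h^{la}_U(n)$ be the maxima, over all problems $z$ over $U$ of dimension at most $n$, of the minimum depth of a decision tree over $z$ that solves $z$ deterministically, respectively nondeterministically, and let $L^{ld}_U(n)$, $L^{la}_U(n)$ be the same with the number of nodes (root included) in place of the depth. The system $U$ satisfies the condition of reduction if there is $m\in\mathbb N$ such that each system of equations $\{f_1(x)=\delta_1,\dots,f_r(x)=\delta_r\}$ with $r\in\mathbb N$, $f_i\in F$, $\delta_i\in\{0,1\}$ that has a solution in $A$ has a subsystem of at most $m$ equations with the same set of solutions in $A$. Let $I(U)\in\{0,1,\dots\}\cup\{\infty\}$ be the supremum of the cardinalities of the finite sets $\{f_1,\dots,f_m\}\subseteq F$ such that, for all $\delta_1,\dots,\delta_m\in\{0,1\}$, the system $\{f_1(x)=\delta_1,\dots,f_m(x)=\delta_m\}$ has a solution in $A$. A function $g:\mathbb N\to\mathbb N$ that is one of these four functions of $U$ has the type of behavior CON if $g(n)=O(1)$; LOG if $g(n)=\Theta(\log n)$; LIN if $g(n)=n$ for all $n\in\mathbb N$; POL if $I(U)<\infty$ and $2(n+1)\le g(n)\le 2(4n)^{I(U)}$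 for all $n\in\mathbb N$; EXP if $g(n)=2^{n+1}$ for all $n\in\mathbb N$. A local type of $U$ is a tuple of types of behavior of $(h^{ld}_U,h^{la}_U,L^{ld}_U,L^{la}_U)$. Theorem 1. (a) Each infinite binary information system $U$ has exactly one local type, and it is one of the three rows 1. (LOG, CON, POL, POL), 2. (LIN, LIN, POL, POL), 3. (LIN, LIN, EXP, EXP). Row 1 occurs if and only if $U$ satisfies the condition of reduction, row 2 if and only if $U$ does not satisfy it and $I(U)<\infty$, and row 3 if and only if $I(U)=\infty$. (b) Each row is the local type of some system. For $i,j\in\mathbb N$ let $l_i(j)=1$ if $j>i$ and $l_i(j)=0$ otherwise, and let $p_i(j)=1$ if $j=i$ and $p_i(j)=0$ otherwise. Then $(\mathbb N,\{l_i:i\in\mathbb N\})$ has local type 1, $(\mathbb N,\{p_i:i\in\mathbb N\})$ has local type 2, and $(\mathbb N,\{0,1\}^{\mathbb N})$ has local type 3. -/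

import Mathlib

open Filter Asymptotics

universe u

/-- An infinite binary information system `U = (A, F)`: an infinite set of objects together with
an infinite set of attributes, i.e. functions from the universe to `{0, 1}`
(`Bool`, with `false` for `0` and `true` for `1`). -/
structure InfoSystem where
  /-- the universe (set of objects) -/
  Obj : Type u
  /-- the set of attributes -/
  attrs : Set (Obj → Bool)
  infinite_obj : Infinite Obj
  infinite_attrs : attrs.Infinite

/-! ### Problems -/

/-- A problem `z = (ν, f₁, …, fₙ)` of dimension `n` over `U`. Decisions are positive integers. -/
structure Problem (U : InfoSystem.{u}) (n : ℕ) where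
  /-- the decision attached to each tuple of attribute values -/
  ν : (Fin n → Bool) → ℕ+
  /-- the attributes, not necessarily pairwise distinct -/
  attr : Fin n → U.Obj → Bool
  attr_mem : ∀ i, attr i ∈ U.attrs

/-- The value `z(a) = ν (f₁(a), …, fₙ(a))`. -/
def Problem.value {U : InfoSystem.{u}} {n : ℕ} (z : Problem U n) (a : U.Obj) : ℕ+ :=
  z.ν (fun i => z.attr i a)

/-! ### Decision trees -/

/-- The part of a decision tree that hangs below an edge: either a terminal node labeled with a
decision, or a working node labeled with an attribute `f`, from which `k + 1` edges leave,
the `i`-th one labeled with the number `edge i` and entering the tree `child i`. -/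
inductive Subtree (A : Type u) : Type u
  | terminal (d : ℕ+) : Subtree A
  | working (f : A → Bool) (k : ℕ) (edge : Fin (k + 1) → Bool)
      (child : Fin (k + 1) → Subtree A) : Subtree A

namespace Subtree

variable {A : Type u}

/-- The maximum number of working nodes on a path to a terminal node. -/
def depth : Subtree A → ℕ
  | terminal _ => 0
  | working _ _ _ child => 1 + Finset.univ.sup (fun i => (child i).depth)

/-- The number of nodes. -/
def size : Subtree A → ℕ
  | terminal _ => 1
  | working _ _ _ child => 1 + ∑ i, (child i).size

/-- Every working node is labeled with an attribute from `S`. -/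
def LabeledIn (S : Set (A → Bool)) : Subtree A → Prop
  | terminal _ => True
  | working f _ _ child => f ∈ S ∧ ∀ i, (child i).LabeledIn S

/-- Edges leaving the same working node are labeled with different numbers. -/
def EdgesDistinct : Subtree A → Prop
  | terminal _ => True
  | working _ _ edge child => Function.Injective edge ∧ ∀ i, (child i).EdgesDistinct

/-- `T.Path l d`: there is a directed path from the top node of `T` to a terminal node labeled
with `d`, along which the attributes of the working nodes and the numbers of the edges leaving
them are, in this order, the pairs in `l`. -/
inductive Path : Subtree A → List ((A → Bool) × Bool) → ℕ+ → Prop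
  | terminal (d : ℕ+) : Path (terminal d) [] d
  | working (f : A → Bool) (k : ℕ) (edge : Fin (k + 1) → Bool)
      (child : Fin (k + 1) → Subtree A) (i : Fin (k + 1))
      (l : List ((A → Bool) × Bool)) (d : ℕ+) (h : Path (child i) l d) :
      Path (working f k edge child) ((f, edge i) :: l) d

end Subtree

/-- A decision tree: an unlabeled root, from which `k + 1` unlabeled edges leave. -/
structure DecisionTree (A : Type u) where
  k : ℕ
  child : Fin (k + 1) → Subtree A

namespace DecisionTree

variable {A : Type u}

/-- The depth `h(Γ)`: the maximum number of working nodes in a complete path. -/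
def depth (Γ : DecisionTree A) : ℕ := Finset.univ.sup (fun i => (Γ.child i).depth)

/-- The number `L(Γ)` of nodes, including the root. -/
def size (Γ : DecisionTree A) : ℕ := 1 + ∑ i, (Γ.child i).size

/-- Every working node is labeled with an attribute from `S`. -/
def LabeledIn (Γ : DecisionTree A) (S : Set (A → Bool)) : Prop := ∀ i, (Γ.child i).LabeledIn S

/-- Only one edge leaves the root, and edges leaving the same working node are labeled with
different numbers. -/
def Deterministic (Γ : DecisionTree A) : Prop := Γ.k = 0 ∧ ∀ i, (Γ.child i).EdgesDistinct

/-- `Γ` has a complete path with the sequence `l` of (attribute, number) pairs whose terminal node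
is labeled with `d`. -/
def CompletePath (Γ : DecisionTree A) (l : List ((A → Bool) × Bool)) (d : ℕ+) : Prop :=
  ∃ i, (Γ.child i).Path l d

end DecisionTree

/-- The set `A(ξ)` of the objects that satisfy all equations along a path. -/
def pathSet {A : Type u} (l : List ((A → Bool) × Bool)) : Set A := {a | ∀ e ∈ l, e.1 a = e.2}

namespace Problem

variable {U : InfoSystem.{u}} {n : ℕ}

/-- `Γ` is a decision tree over `z`: it uses only attributes from the description of `z`. -/
def IsTreeOver (z : Problem U n) (Γ : DecisionTree U.Obj) : Prop := Γ.LabeledIn (Set.range z.attr)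

/-- `Γ` is a decision tree over `z` that solves `z` nondeterministically. -/
def SolvedNondet (z : Problem U n) (Γ : DecisionTree U.Obj) : Prop :=
  z.IsTreeOver Γ ∧
  (∀ a, ∃ l d, Γ.CompletePath l d ∧ a ∈ pathSet l) ∧
  (∀ a l d, Γ.CompletePath l d → a ∈ pathSet l → d = z.value a)

/-- `Γ` is a decision tree over `z` that solves `z` deterministically. -/
def SolvedDet (z : Problem U n) (Γ : DecisionTree U.Obj) : Prop :=
  Γ.Deterministic ∧ z.SolvedNondet Γ

/-- minimum depth of a tree over `z` solving `z` deterministically -/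
noncomputable def hld (z : Problem U n) : ℕ := sInf {m | ∃ Γ, z.SolvedDet Γ ∧ Γ.depth = m}

/-- minimum depth of a tree over `z` solving `z` nondeterministically -/
noncomputable def hla (z : Problem U n) : ℕ := sInf {m | ∃ Γ, z.SolvedNondet Γ ∧ Γ.depth = m}

/-- minimum number of nodes of a tree over `z` solving `z` deterministically -/
noncomputable def Lld (z : Problem U n) : ℕ := sInf {m | ∃ Γ, z.SolvedDet Γ ∧ Γ.size = m}

/-- minimum number of nodes of a tree over `z` solving `z` nondeterministically -/
noncomputable def Lla (z : Problem U n) : ℕ := sInf {m | ∃ Γ, z.SolvedNondet Γ ∧ Γ.size = m}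

end Problem

/-! ### The minima and maxima exist

Querying all attributes one after another solves a problem of dimension `n` with depth `n` and
`2 ^ (n + 1)` nodes. Hence the sets under the infima above are nonempty, and the sets under the
suprema in the next part are bounded. -/

/-- The tree that queries all attributes one after another. -/
def queryAll {A : Type u} : (n : ℕ) → (Fin n → A → Bool) → ((Fin n → Bool) → ℕ+) → Subtree A
  | 0, _, ν => .terminal (ν Fin.elim0)
  | n + 1, f, ν => .working (f 0) 1 (fun i => i == 1) (fun i =>
      queryAll n (fun j => f j.succ) (fun v => ν (Fin.cons (i == 1) v)))

theorem depth_queryAll {A : Type u} (n : ℕ) (f : Fin n → A → Bool) (ν : (Fin n → Bool) → ℕ+) :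
    (queryAll n f ν).depth = n := by
  induction n with
  | zero => rfl
  | succ n ih => simp [queryAll, Subtree.depth, ih, Finset.sup_const, add_comm]

theorem size_queryAll {A : Type u} (n : ℕ) (f : Fin n → A → Bool) (ν : (Fin n → Bool) → ℕ+) :
    1 + (queryAll n f ν).size = 2 ^ (n + 1) := by
  induction n with
  | zero => rfl
  | succ n ih =>
    have h : ∀ i : Fin 2, (queryAll n (fun j => f j.succ)
        (fun v => ν (Fin.cons (i == 1) v))).size = 2 ^ (n + 1) - 1 := fun i => by
      rw [← ih (fun j => f j.succ) (fun v => ν (Fin.cons (i == 1) v))]; omega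
    have h1 : 1 ≤ 2 ^ (n + 1) := Nat.one_le_two_pow
    have h2 : 2 ^ (n + 1 + 1) = 2 * 2 ^ (n + 1) := by ring
    simp only [queryAll, Subtree.size, h, Nat.reduceAdd, Finset.sum_const, Finset.card_univ,
      Fintype.card_fin, smul_eq_mul]
    omega

theorem labeledIn_queryAll {A : Type u} (S : Set (A → Bool)) (n : ℕ) (f : Fin n → A → Bool)
    (ν : (Fin n → Bool) → ℕ+) (h : ∀ i, f i ∈ S) : (queryAll n f ν).LabeledIn S := by
  induction n with
  | zero => trivial
  | succ n ih => exact ⟨h 0, fun i => ih _ _ fun j => h j.succ⟩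

theorem edgesDistinct_queryAll {A : Type u} (n : ℕ) (f : Fin n → A → Bool)
    (ν : (Fin n → Bool) → ℕ+) : (queryAll n f ν).EdgesDistinct := by
  induction n with
  | zero => trivial
  | succ n ih =>
    refine ⟨fun i j hij => ?_, fun i => ih _ _⟩
    change Fin 2 at i j
    revert i j
    decide

theorem exists_path_queryAll {A : Type u} (a : A) (n : ℕ) (f : Fin n → A → Bool)
    (ν : (Fin n → Bool) → ℕ+) : ∃ l d, (queryAll n f ν).Path l d ∧ a ∈ pathSet l := by
  induction n with
  | zero => exact ⟨[], _, .terminal _, by simp [pathSet]⟩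
  | succ n ih =>
    let i : Fin 2 := if f 0 a then 1 else 0
    have hi : f 0 a = (i == 1) := by
      simp only [i]
      cases f 0 a <;> decide
    obtain ⟨l, d, h, ha⟩ := ih (fun j => f j.succ) (fun v => ν (Fin.cons (i == 1) v))
    refine ⟨_, d, .working _ _ _ _ i l d h, ?_⟩
    rintro e (_ | ⟨_, he⟩)
    · exact hi
    · exact ha e he

theorem eq_of_path_queryAll {A : Type u} (a : A) (n : ℕ) (f : Fin n → A → Bool)
    (ν : (Fin n → Bool) → ℕ+) (l : List ((A → Bool) × Bool)) (d : ℕ+)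
    (h : (queryAll n f ν).Path l d) (ha : a ∈ pathSet l) : d = ν (fun i => f i a) := by
  induction n generalizing l with
  | zero =>
    cases h
    congr 1
    exact Subsingleton.elim _ _
  | succ n ih =>
    rw [queryAll] at h
    cases h with
    | working _ _ _ _ i l _ h =>
      have h0 : f 0 a = (i == 1) := ha (f 0, i == 1) List.mem_cons_self
      rw [ih _ _ l h fun e he => ha e (List.mem_cons_of_mem _ he), ← h0]
      congr 1
      funext j
      refine Fin.cases ?_ (fun j => ?_) j <;> simp

/-- Every problem is solved deterministically by a tree of depth `n` with `2 ^ (n + 1)` nodes. -/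
theorem Problem.exists_solvedDet {U : InfoSystem.{u}} {n : ℕ} (z : Problem U n) :
    ∃ Γ, z.SolvedDet Γ ∧ Γ.depth = n ∧ Γ.size = 2 ^ (n + 1) := by
  refine ⟨⟨0, fun _ => queryAll n z.attr z.ν⟩, ⟨⟨rfl, fun _ => edgesDistinct_queryAll _ _ _⟩,
    fun _ => labeledIn_queryAll _ _ _ _ fun i => ⟨i, rfl⟩, fun a => ?_, ?_⟩, ?_, ?_⟩
  · obtain ⟨l, d, h, ha⟩ := exists_path_queryAll a n z.attr z.ν
    exact ⟨l, d, ⟨0, h⟩, ha⟩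
  · rintro a l d ⟨_, h⟩ ha
    exact eq_of_path_queryAll a n z.attr z.ν l d h ha
  · simp [DecisionTree.depth, depth_queryAll]
  · simp [DecisionTree.size, size_queryAll]

theorem Problem.bounds {U : InfoSystem.{u}} {n : ℕ} (z : Problem U n) :
    z.hld ≤ n ∧ z.hla ≤ n ∧ z.Lld ≤ 2 ^ (n + 1) ∧ z.Lla ≤ 2 ^ (n + 1) := by
  obtain ⟨Γ, h, h1, h2⟩ := z.exists_solvedDet
  exact ⟨Nat.sInf_le ⟨Γ, h, h1⟩, Nat.sInf_le ⟨Γ, h.2, h1⟩, Nat.sInf_le ⟨Γ, h, h2⟩,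
    Nat.sInf_le ⟨Γ, h.2, h2⟩⟩

namespace InfoSystem

/-! ### The four worst-case functions

The maximum is over all problems `z` with `1 ≤ dim z ≤ n`; the functions are only considered for
`n ≥ 1`. -/

noncomputable def hld (U : InfoSystem.{u}) (n : ℕ) : ℕ :=
  sSup {m | ∃ k, 1 ≤ k ∧ k ≤ n ∧ ∃ z : Problem U k, z.hld = m}

noncomputable def hla (U : InfoSystem.{u}) (n : ℕ) : ℕ :=
  sSup {m | ∃ k, 1 ≤ k ∧ k ≤ n ∧ ∃ z : Problem U k, z.hla = m}

noncomputable def Lld (U : InfoSystem.{u}) (n : ℕ) : ℕ :=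
  sSup {m | ∃ k, 1 ≤ k ∧ k ≤ n ∧ ∃ z : Problem U k, z.Lld = m}

noncomputable def Lla (U : InfoSystem.{u}) (n : ℕ) : ℕ :=
  sSup {m | ∃ k, 1 ≤ k ∧ k ≤ n ∧ ∃ z : Problem U k, z.Lla = m}

/-! ### Condition of reduction and independence dimension -/

/-- The condition of reduction: for some `m ≥ 1`, every compatible system of equations
`f₁(x) = δ₁, …, f_r(x) = δ_r` over `U` has a subsystem of at most `m` equations with the same set
of solutions. -/
def Reduction (U : InfoSystem.{u}) : Prop :=
  ∃ m : ℕ, 1 ≤ m ∧ ∀ (r : ℕ) (f : Fin r → U.Obj → Bool) (δ : Fin r → Bool), 1 ≤ r →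
    (∀ i, f i ∈ U.attrs) → (∃ a, ∀ i, f i a = δ i) →
    ∃ s : Finset (Fin r), s.card ≤ m ∧ {a | ∀ i ∈ s, f i a = δ i} = {a | ∀ i, f i a = δ i}

/-- A finite set of attributes is independent if all the systems of equations that assign a value
to each of them are solvable. -/
def Independent (U : InfoSystem.{u}) (S : Finset (U.Obj → Bool)) : Prop :=
  (S : Set (U.Obj → Bool)) ⊆ U.attrs ∧
    ∀ δ : (U.Obj → Bool) → Bool, ∃ a, ∀ f ∈ S, f a = δ f

/-- The independence dimension `I(U)`, possibly `∞`. -/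
noncomputable def iDim (U : InfoSystem.{u}) : ℕ∞ :=
  ⨆ (S : Finset (U.Obj → Bool)) (_ : U.Independent S), (S.card : ℕ∞)

end InfoSystem

/-! ### Types of behavior and local types -/

/-- Names of the types of behavior. -/
inductive Behavior
  | CON | LOG | LIN | POL | EXP

/-- The function `g` (one of the four functions of `U`) has the given type of behavior. -/
def InfoSystem.HasBehavior (U : InfoSystem.{u}) (g : ℕ → ℕ) : Behavior → Prop
  | .CON => (fun n => (g n : ℝ)) =O[atTop] (fun _ => (1 : ℝ))
  | .LOG => (fun n => (g n : ℝ)) =Θ[atTop] (fun n : ℕ => Real.log n)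
  | .LIN => ∀ n, 1 ≤ n → g n = n
  | .POL => ∃ d : ℕ, U.iDim = d ∧ ∀ n, 1 ≤ n → 2 * (n + 1) ≤ g n ∧ g n ≤ 2 * (4 * n) ^ d
  | .EXP => ∀ n, 1 ≤ n → g n = 2 ^ (n + 1)

/-- A possible local type: types of behavior for `h^{ld}`, `h^{la}`, `L^{ld}` and `L^{la}`. -/
@[ext]
structure LocalType where
  hld : Behavior
  hla : Behavior
  Lld : Behavior
  Lla : Behavior

/-- `t` is a local type of `U`. -/
def InfoSystem.HasLocalType (U : InfoSystem.{u}) (t : LocalType) : Prop :=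
  U.HasBehavior U.hld t.hld ∧ U.HasBehavior U.hla t.hla ∧
  U.HasBehavior U.Lld t.Lld ∧ U.HasBehavior U.Lla t.Lla

def row1 : LocalType := ⟨.LOG, .CON, .POL, .POL⟩

def row2 : LocalType := ⟨.LIN, .LIN, .POL, .POL⟩

def row3 : LocalType := ⟨.LIN, .LIN, .EXP, .EXP⟩

/-! ### Three explicit systems on the set `{1, 2, 3, …}` -/

/-- `l_i (j) = 1` if and only if `j > i`. -/
def thresholdAttr (i j : ℕ+) : Bool := decide (j > i)

/-- `p_i (j) = 1` if and only if `j = i`. -/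
def pointAttr (i j : ℕ+) : Bool := decide (j = i)

theorem thresholdAttr_injective : Function.Injective thresholdAttr := by
  intro i j h
  have h1 := congrFun h i
  have h2 := congrFun h j
  simp only [thresholdAttr, gt_iff_lt, decide_eq_decide, lt_self_iff_false, false_iff,
    iff_false, not_lt] at h1 h2
  exact le_antisymm h1 h2

theorem pointAttr_injective : Function.Injective pointAttr := by
  intro i j h
  have h1 := congrFun h i
  simpa [pointAttr] using h1

/-- All threshold attributes. -/
def thresholdSystem : InfoSystem.{0} where
  Obj := ℕ+
  attrs := Set.range thresholdAttr
  infinite_obj := inferInstance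
  infinite_attrs := Set.infinite_range_of_injective thresholdAttr_injective

/-- All point attributes. -/
def pointSystem : InfoSystem.{0} where
  Obj := ℕ+
  attrs := Set.range pointAttr
  infinite_obj := inferInstance
  infinite_attrs := Set.infinite_range_of_injective pointAttr_injective

/-- All functions to `{0, 1}`. -/
def allSystem : InfoSystem.{0} where
  Obj := ℕ+
  attrs := Set.univ
  infinite_obj := inferInstance
  infinite_attrs :=
    (Set.infinite_range_of_injective pointAttr_injective).mono (Set.subset_univ _)

/-!
The four functions are bounded by means of three properties of finite families of attributes.

*Lower bounds.* An infinite set of attributes contains irredundant families of every size `n`,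
since a set of attributes determines only finitely many others (`exists_irredundant`). Such a family
has at least `n + 1` value vectors. Consider the problem of finding the value vector. A solving tree
needs `n + 1` different decisions and has to query all `n` attributes, hence it has at least
`2 * (n + 1)` nodes; if it is deterministic, then `n + 1 ≤ 2 ^ depth`. If the condition of reduction
fails, there are systems of `n` equations, none of which follows from the others, satisfied by some
object; a path for this object has to query all `n` attributes, which gives depth `n` also for
nondeterministic trees. If the independence dimension is infinite, then all `2 ^ n` value vectors
occur for some families, and every path queries all attributes. A node that is reached after `i`
different queries lies on the paths of at most `2 ^ (n - i)` vectors, and counting nodes with this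
weight gives `2 ^ (n + 1)` nodes (`Subtree.two_mul_pow_mul_card_le`).

*Upper bounds.* If the independence dimension is `d`, then by the Sauer–Shelah lemma `n` attributes
have at most `(4 * n) ^ d` value vectors, and a tree without superfluous working nodes has twice as
many nodes (`card_valueVectors_le`, `Subtree.exists_computesOn_size_le`). Under the condition of
reduction, every system of equations has a subsystem of bounded size that leaves at most one value
vector (`exists_certificates`). Applied to the systems satisfied by objects, this yields
nondeterministic trees of bounded depth. Applied to the majority values among the remaining value
vectors, it yields a deterministic tree in which a bounded number of queries halves the number of
these vectors, so that the depth is `O(log n)` (`Subtree.exists_computesOn_depth_le`).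

The condition of reduction implies a finite independence dimension, so exactly one of the three
cases applies to each system. No function has two of the types of behavior, which makes the local
type unique.
-/

/-! ### Nodes and paths of a tree -/

namespace Subtree

variable {A : Type u}

/-- The attributes of the working nodes, one entry for each node. -/
def attrs : Subtree A → Multiset (A → Bool)
  | terminal _ => 0
  | working f _ _ child => f ::ₘ ∑ i, (child i).attrs

/-- The decisions of the terminal nodes, one entry for each node. -/
def labels : Subtree A → Multiset ℕ+
  | terminal d => {d}
  | working _ _ _ child => ∑ i, (child i).labels

theorem size_eq_card_add_card (T : Subtree A) : T.size = T.attrs.card + T.labels.card := by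
  induction T with
  | terminal d => rfl
  | working f k edge child ih =>
    simp only [size, attrs, labels, ih, Multiset.card_cons, Multiset.card_sum,
      Finset.sum_add_distrib]
    omega

theorem card_labels_le {T : Subtree A} (h : T.EdgesDistinct) : T.labels.card ≤ 2 ^ T.depth := by
  induction T with
  | terminal d => simp [labels, depth]
  | working f k edge child ih =>
    obtain ⟨hinj, hc⟩ := h
    have hk : k + 1 ≤ 2 := by simpa using Fintype.card_le_of_injective edge hinj
    simp only [labels, depth, Multiset.card_sum]
    calc ∑ i, (child i).labels.card
        ≤ ∑ _i : Fin (k + 1), 2 ^ (Finset.univ.sup fun i => (child i).depth) :=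
          Finset.sum_le_sum fun i _ => (ih i (hc i)).trans
            (Nat.pow_le_pow_right two_pos
              (Finset.le_sup (f := fun i => (child i).depth) (Finset.mem_univ i)))
      _ ≤ _ := by
          rw [Finset.sum_const, Finset.card_univ, Fintype.card_fin, smul_eq_mul, pow_add, pow_one]
          exact Nat.mul_le_mul_right _ hk

theorem Path.length_le_depth {T : Subtree A} {l : List ((A → Bool) × Bool)} {d : ℕ+}
    (h : T.Path l d) : l.length ≤ T.depth := by
  induction h with
  | terminal d => simp
  | working f k edge child i l d h ih =>
    have := Finset.le_sup (f := fun i => (child i).depth) (Finset.mem_univ i)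
    simp only [List.length_cons, depth] at *
    omega

theorem Path.label_mem {T : Subtree A} {l : List ((A → Bool) × Bool)} {d : ℕ+}
    (h : T.Path l d) : d ∈ T.labels := by
  induction h with
  | terminal d => simp [labels]
  | working f k edge child i l d h ih =>
    exact Multiset.mem_sum.2 ⟨i, Finset.mem_univ i, ih⟩

theorem Path.attr_mem {T : Subtree A} {l : List ((A → Bool) × Bool)} {d : ℕ+}
    (h : T.Path l d) : ∀ e ∈ l, e.1 ∈ T.attrs := by
  induction h with
  | terminal d => simp
  | working f k edge child i l d h ih =>
    rintro e he
    rcases List.mem_cons.1 he with rfl | he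
    · exact Multiset.mem_cons_self _ _
    · exact Multiset.mem_cons_of_mem (Multiset.mem_sum.2 ⟨i, Finset.mem_univ i, ih e he⟩)

theorem Path.mem_of_labeledIn {T : Subtree A} {l : List ((A → Bool) × Bool)} {d : ℕ+}
    (h : T.Path l d) {S : Set (A → Bool)} (hT : T.LabeledIn S) : ∀ e ∈ l, e.1 ∈ S := by
  induction h with
  | terminal d => simp
  | working f k edge child i l d h ih =>
    rintro e he
    rcases List.mem_cons.1 he with rfl | he
    · exact hT.1
    · exact ih (hT.2 i) e he

/-- In a tree for `2 ^ n` objects `x v` that realize all value vectors `v` of `n` attributes, let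
`G` be the attributes that a path still has to query. If the objects `x v`, `v ∈ C`, follow such
paths and the vectors in `C` differ only on `G`, then the tree has at least
`|C| * (2 - 2 ^ (-|G|))` nodes; the inequality is cleared of denominators. The bound is linear
in `|C|`, so a node whose attribute is not in `G` or that has several edges with the same label
does no harm; a node whose attribute is in `G` contributes `1 ≥ |C| * 2 ^ (-|G|)`. -/
theorem two_mul_pow_mul_card_le {n : ℕ} {f : Fin n → A → Bool} {x : (Fin n → Bool) → A}
    (hx : ∀ v i, f i (x v) = v i) (hf : Function.Injective f) (T : Subtree A)
    (G : Finset (Fin n)) (C : Finset (Fin n → Bool))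
    (hC : ∀ v ∈ C, ∃ l d, T.Path l d ∧ x v ∈ pathSet l ∧ ∀ i ∈ G, ∃ e ∈ l, e.1 = f i)
    (hG : ∀ v ∈ C, ∀ w ∈ C, ∀ i ∉ G, v i = w i) :
    2 * 2 ^ G.card * C.card ≤ 2 ^ G.card * T.size + C.card := by
  classical
  have hcard : ∀ {G : Finset (Fin n)} {C : Finset (Fin n → Bool)},
      (∀ v ∈ C, ∀ w ∈ C, ∀ i ∉ G, v i = w i) → C.card ≤ 2 ^ G.card := by
    intro G C hG
    have := Finset.card_le_card_of_injOn (s := C) (t := (Finset.univ : Finset (G → Bool)))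
      (fun v i => v i) (fun _ _ => Finset.mem_coe.2 (Finset.mem_univ _)) (by
        intro v hv w hw h
        funext i
        by_cases hi : i ∈ G
        · exact congrFun h ⟨i, hi⟩
        · exact hG v hv w hw i hi)
    simpa using this
  induction T generalizing G C with
  | terminal d =>
    have hG0 : C.Nonempty → G = ∅ := by
      rintro ⟨v, hv⟩
      obtain ⟨l, d, hp, -, h⟩ := hC v hv
      cases hp
      exact Finset.eq_empty_of_forall_notMem fun i hi => by simpa using h i hi
    rcases C.eq_empty_or_nonempty with rfl | hne
    · simp
    · have h1 := hcard hG
      rw [hG0 hne] at h1 ⊢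
      simp only [Finset.card_empty, pow_zero, size] at *
      omega
  | working g k edge child ih =>
    have hex : ∀ v : Fin n → Bool, ∃ i : Fin (k + 1), v ∈ C →
        g (x v) = edge i ∧ ∃ l d, (child i).Path l d ∧ x v ∈ pathSet l ∧
          ∀ j ∈ G, f j ≠ g → ∃ e ∈ l, e.1 = f j := by
      intro v
      by_cases hv : v ∈ C
      · obtain ⟨l, d, hp, ha, h⟩ := hC v hv
        cases hp with
        | working _ _ _ _ i l _ hp =>
          refine ⟨i, fun _ => ⟨ha (g, edge i) List.mem_cons_self, l, d, hp,
            fun e he => ha e (List.mem_cons_of_mem _ he), fun j hj hne => ?_⟩⟩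
          obtain ⟨e, he, hej⟩ := h j hj
          rcases List.mem_cons.1 he with rfl | he
          · exact absurd hej.symm hne
          · exact ⟨e, he, hej⟩
      · exact ⟨0, fun h => absurd h hv⟩
    choose idx hidx using hex
    let D : Fin (k + 1) → Finset (Fin n → Bool) := fun i => C.filter fun v => idx v = i
    have hsum : C.card = ∑ i, (D i).card :=
      Finset.card_eq_sum_card_fiberwise fun v _ => Finset.mem_coe.2 (Finset.mem_univ _)
    by_cases hg : ∃ j ∈ G, f j = g
    · obtain ⟨j, hj, rfl⟩ := hg
      have hi : ∀ i, 2 * 2 ^ (G.erase j).card * (D i).card ≤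
          2 ^ (G.erase j).card * (child i).size + (D i).card := by
        intro i
        refine ih i (G.erase j) (D i) (fun v hv => ?_) fun v hv w hw t ht => ?_
        · obtain ⟨hvC, rfl⟩ := Finset.mem_filter.1 hv
          obtain ⟨-, l, d, hp, ha, h⟩ := hidx v hvC
          exact ⟨l, d, hp, ha, fun t ht => h t (Finset.mem_of_mem_erase ht)
            (hf.ne (Finset.ne_of_mem_erase ht))⟩
        · obtain ⟨hv, hvi⟩ := Finset.mem_filter.1 hv
          obtain ⟨hw, hwi⟩ := Finset.mem_filter.1 hw
          by_cases htj : t = j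
          · subst htj
            rw [← hx v t, ← hx w t, (hidx v hv).1, (hidx w hw).1, hvi, hwi]
          · exact hG v hv w hw t fun h => ht (Finset.mem_erase.2 ⟨htj, h⟩)
      have hs := Finset.sum_le_sum fun i (_ : i ∈ Finset.univ) => hi i
      rw [Finset.sum_add_distrib, ← Finset.mul_sum, ← Finset.mul_sum, ← hsum] at hs
      have hC2 := hcard hG
      rw [← Finset.card_erase_add_one hj, pow_succ] at hC2 ⊢
      simp only [size]
      nlinarith
    · have hi : ∀ i, 2 * 2 ^ G.card * (D i).card ≤ 2 ^ G.card * (child i).size + (D i).card := by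
        intro i
        refine ih i G (D i) (fun v hv => ?_) fun v hv w hw t ht =>
          hG v (Finset.mem_filter.1 hv).1 w (Finset.mem_filter.1 hw).1 t ht
        obtain ⟨hvC, rfl⟩ := Finset.mem_filter.1 hv
        obtain ⟨-, l, d, hp, ha, h⟩ := hidx v hvC
        exact ⟨l, d, hp, ha, fun t ht => h t ht fun h => hg ⟨t, ht, h⟩⟩
      have hs := Finset.sum_le_sum fun i (_ : i ∈ Finset.univ) => hi i
      rw [Finset.sum_add_distrib, ← Finset.mul_sum, ← Finset.mul_sum, ← hsum] at hs
      simp only [size, mul_add, mul_one]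
      linarith [Nat.zero_le (2 ^ G.card)]

end Subtree

/-! ### Lower bounds for trees that solve a problem -/

namespace DecisionTree

variable {A : Type u} {Γ : DecisionTree A}

theorem CompletePath.length_le_depth {l : List ((A → Bool) × Bool)} {d : ℕ+}
    (h : Γ.CompletePath l d) : l.length ≤ Γ.depth := by
  obtain ⟨i, h⟩ := h
  exact h.length_le_depth.trans
    (Finset.le_sup (f := fun i => (Γ.child i).depth) (Finset.mem_univ i))

/-- A path that queries `n` different attributes has at least `n` working nodes. -/
theorem CompletePath.le_depth {n : ℕ} {f : Fin n → A → Bool} (hf : Function.Injective f)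
    {l : List ((A → Bool) × Bool)} {d : ℕ+} (h : Γ.CompletePath l d)
    (hl : ∀ i, ∃ e ∈ l, e.1 = f i) : n ≤ Γ.depth := by
  classical
  refine le_trans ?_ h.length_le_depth
  have h1 : Finset.univ.image f ⊆ (l.map Prod.fst).toFinset := by
    intro g hg
    obtain ⟨i, -, rfl⟩ := Finset.mem_image.1 hg
    obtain ⟨e, he, hei⟩ := hl i
    exact List.mem_toFinset.2 (List.mem_map.2 ⟨e, he, hei⟩)
  have h2 := (Finset.card_le_card h1).trans (List.toFinset_card_le _)
  rwa [Finset.card_image_of_injective _ hf, Finset.card_univ, Fintype.card_fin,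
    List.length_map] at h2

/-- Distinct attributes that occur on complete paths and distinct decisions of complete paths
account for different nodes. -/
theorem card_add_card_lt_size {E : Finset (A → Bool)} {D : Finset ℕ+}
    (hE : ∀ g ∈ E, ∃ l d, Γ.CompletePath l d ∧ ∃ e ∈ l, e.1 = g)
    (hD : ∀ d ∈ D, ∃ l, Γ.CompletePath l d) : E.card + D.card < Γ.size := by
  have h1 : E.val ≤ ∑ i, (Γ.child i).attrs :=
    (Multiset.le_iff_subset E.nodup).2 fun g hg => by
      obtain ⟨l, d, ⟨i, h⟩, e, he, rfl⟩ := hE g hg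
      exact Multiset.mem_sum.2 ⟨i, Finset.mem_univ i, h.attr_mem e he⟩
  have h2 : D.val ≤ ∑ i, (Γ.child i).labels :=
    (Multiset.le_iff_subset D.nodup).2 fun d hd => by
      obtain ⟨l, i, h⟩ := hD d hd
      exact Multiset.mem_sum.2 ⟨i, Finset.mem_univ i, h.label_mem⟩
  have h3 := Multiset.card_le_card h1
  have h4 := Multiset.card_le_card h2
  simp only [Multiset.card_sum, Finset.card_val] at h3 h4
  simp only [size, Subtree.size_eq_card_add_card, Finset.sum_add_distrib]
  omega

theorem Deterministic.card_le {D : Finset ℕ+} (h : Γ.Deterministic)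
    (hD : ∀ d ∈ D, ∃ l, Γ.CompletePath l d) : D.card ≤ 2 ^ Γ.depth := by
  obtain ⟨k, child⟩ := Γ
  obtain ⟨rfl : k = 0, h⟩ := h
  have h2 : D.val ≤ (child 0).labels :=
    (Multiset.le_iff_subset D.nodup).2 fun d hd => by
      obtain ⟨l, i, h⟩ := hD d hd
      change Fin 1 at i
      rw [Subsingleton.elim i 0] at h
      exact h.label_mem
  refine (Multiset.card_le_card h2).trans ((Subtree.card_labels_le (h 0)).trans ?_)
  exact Nat.pow_le_pow_right two_pos
    (Finset.le_sup (f := fun i => (child i).depth) (Finset.mem_univ 0))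

end DecisionTree

namespace Problem

variable {U : InfoSystem.{u}} {n : ℕ} {z : Problem U n} {Γ : DecisionTree U.Obj}

/-- If two objects with different solutions differ on the `i`-th attribute only, then a path
followed by one of them has to query this attribute. -/
theorem SolvedNondet.exists_mem_eq_attr (h : z.SolvedNondet Γ) {l : List ((U.Obj → Bool) × Bool)}
    {d : ℕ+} (hp : Γ.CompletePath l d) {a b : U.Obj} (ha : a ∈ pathSet l) (i : Fin n)
    (hne : z.value a ≠ z.value b) (hab : ∀ j, j ≠ i → z.attr j a = z.attr j b) :
    ∃ e ∈ l, e.1 = z.attr i := by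
  by_contra! hl
  refine hne ((h.2.2 a l d hp ha).symm.trans (h.2.2 b l d hp fun e he => ?_))
  obtain ⟨t, ht⟩ := hp
  obtain ⟨j, hj⟩ := ht.mem_of_labeledIn (h.1 t) e he
  rw [← hj, ← hab j, hj]
  · exact ha e he
  · rintro rfl
    exact hl e he hj.symm

theorem SolvedNondet.hla_le (h : z.SolvedNondet Γ) : z.hla ≤ Γ.depth := Nat.sInf_le ⟨Γ, h, rfl⟩

theorem SolvedDet.hld_le (h : z.SolvedDet Γ) : z.hld ≤ Γ.depth := Nat.sInf_le ⟨Γ, h, rfl⟩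

theorem SolvedNondet.Lla_le (h : z.SolvedNondet Γ) : z.Lla ≤ Γ.size := Nat.sInf_le ⟨Γ, h, rfl⟩

theorem SolvedDet.Lld_le (h : z.SolvedDet Γ) : z.Lld ≤ Γ.size := Nat.sInf_le ⟨Γ, h, rfl⟩

theorem le_hla {c : ℕ} (h : ∀ Γ, z.SolvedNondet Γ → c ≤ Γ.depth) : c ≤ z.hla := by
  obtain ⟨Γ, hΓ, -⟩ := z.exists_solvedDet
  exact le_csInf ⟨_, Γ, hΓ.2, rfl⟩ (by rintro _ ⟨Γ, hΓ, rfl⟩; exact h Γ hΓ)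

theorem le_Lla {c : ℕ} (h : ∀ Γ, z.SolvedNondet Γ → c ≤ Γ.size) : c ≤ z.Lla := by
  obtain ⟨Γ, hΓ, -⟩ := z.exists_solvedDet
  exact le_csInf ⟨_, Γ, hΓ.2, rfl⟩ (by rintro _ ⟨Γ, hΓ, rfl⟩; exact h Γ hΓ)

theorem le_hld {c : ℕ} (h : ∀ Γ, z.SolvedDet Γ → c ≤ Γ.depth) : c ≤ z.hld := by
  obtain ⟨Γ, hΓ, -⟩ := z.exists_solvedDet
  exact le_csInf ⟨_, Γ, hΓ, rfl⟩ (by rintro _ ⟨Γ, hΓ, rfl⟩; exact h Γ hΓ)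

theorem le_Lld {c : ℕ} (h : ∀ Γ, z.SolvedDet Γ → c ≤ Γ.size) : c ≤ z.Lld := by
  obtain ⟨Γ, hΓ, -⟩ := z.exists_solvedDet
  exact le_csInf ⟨_, Γ, hΓ, rfl⟩ (by rintro _ ⟨Γ, hΓ, rfl⟩; exact h Γ hΓ)

theorem hla_le_hld (z : Problem U n) : z.hla ≤ z.hld :=
  le_hld fun _ hΓ => SolvedNondet.hla_le hΓ.2

theorem Lla_le_Lld (z : Problem U n) : z.Lla ≤ z.Lld :=
  le_Lld fun _ hΓ => SolvedNondet.Lla_le hΓ.2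

end Problem

namespace InfoSystem

variable {U : InfoSystem.{u}} {n : ℕ}

theorem _root_.Problem.hld_le {k : ℕ} (z : Problem U k) (h1 : 1 ≤ k) (hk : k ≤ n) :
    z.hld ≤ U.hld n :=
  le_csSup ⟨n, by rintro _ ⟨k, -, hk, z, rfl⟩; exact z.bounds.1.trans hk⟩ ⟨k, h1, hk, z, rfl⟩

theorem _root_.Problem.hla_le {k : ℕ} (z : Problem U k) (h1 : 1 ≤ k) (hk : k ≤ n) :
    z.hla ≤ U.hla n :=
  le_csSup ⟨n, by rintro _ ⟨k, -, hk, z, rfl⟩; exact z.bounds.2.1.trans hk⟩ ⟨k, h1, hk, z, rfl⟩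

theorem _root_.Problem.Lld_le {k : ℕ} (z : Problem U k) (h1 : 1 ≤ k) (hk : k ≤ n) :
    z.Lld ≤ U.Lld n :=
  le_csSup ⟨2 ^ (n + 1), by
    rintro _ ⟨k, -, hk, z, rfl⟩
    exact z.bounds.2.2.1.trans (Nat.pow_le_pow_right two_pos (by omega))⟩ ⟨k, h1, hk, z, rfl⟩

theorem _root_.Problem.Lla_le {k : ℕ} (z : Problem U k) (h1 : 1 ≤ k) (hk : k ≤ n) :
    z.Lla ≤ U.Lla n :=
  le_csSup ⟨2 ^ (n + 1), by
    rintro _ ⟨k, -, hk, z, rfl⟩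
    exact z.bounds.2.2.2.trans (Nat.pow_le_pow_right two_pos (by omega))⟩ ⟨k, h1, hk, z, rfl⟩

theorem hla_le_hld (U : InfoSystem.{u}) (n : ℕ) : U.hla n ≤ U.hld n :=
  csSup_le' (by rintro _ ⟨k, h1, hk, z, rfl⟩; exact z.hla_le_hld.trans (z.hld_le h1 hk))

theorem Lla_le_Lld (U : InfoSystem.{u}) (n : ℕ) : U.Lla n ≤ U.Lld n :=
  csSup_le' (by rintro _ ⟨k, h1, hk, z, rfl⟩; exact z.Lla_le_Lld.trans (z.Lld_le h1 hk))

theorem hld_le (U : InfoSystem.{u}) (n : ℕ) : U.hld n ≤ n :=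
  csSup_le' (by rintro _ ⟨k, h1, hk, z, rfl⟩; exact z.bounds.1.trans hk)

theorem Lld_le (U : InfoSystem.{u}) (n : ℕ) : U.Lld n ≤ 2 ^ (n + 1) :=
  csSup_le' (by
    rintro _ ⟨k, h1, hk, z, rfl⟩
    exact z.bounds.2.2.1.trans (Nat.pow_le_pow_right two_pos (by omega)))

/-- The problem whose solution is the whole vector of attribute values. -/
def identification (U : InfoSystem.{u}) (f : Fin n → U.Obj → Bool) (hf : ∀ i, f i ∈ U.attrs) :
    Problem U n where
  ν v := Nat.succPNat (Encodable.encode v)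
  attr := f
  attr_mem := hf

theorem identification_ν_injective (f : Fin n → U.Obj → Bool) (hf : ∀ i, f i ∈ U.attrs) :
    Function.Injective (U.identification f hf).ν :=
  fun _ _ h => Encodable.encode_injective (Nat.succPNat_injective h)

theorem identification_value_inj {f : Fin n → U.Obj → Bool} {hf : ∀ i, f i ∈ U.attrs}
    {a b : U.Obj} : (U.identification f hf).value a = (U.identification f hf).value b ↔
      (fun i => f i a) = fun i => f i b :=
  (identification_ν_injective f hf).eq_iff

end InfoSystem

/-! ### Families of attributes -/

section Families

variable {A : Type u} {n : ℕ}

/-- The set of the vectors `(f₁(a), …, fₙ(a))`, `a ∈ A`. -/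
noncomputable def valueVectors (f : Fin n → A → Bool) : Finset (Fin n → Bool) :=
  (Set.range fun a i => f i a).toFinite.toFinset

theorem mem_valueVectors {f : Fin n → A → Bool} {v : Fin n → Bool} :
    v ∈ valueVectors f ↔ ∃ a, (fun i => f i a) = v := by
  simp [valueVectors]

/-- A family of attributes is irredundant if none of them is a function of the others. -/
def Irredundant (f : Fin n → A → Bool) : Prop :=
  ∀ i, ∃ a b, f i a ≠ f i b ∧ ∀ j, j ≠ i → f j a = f j b

theorem Irredundant.injective {f : Fin n → A → Bool} (hf : Irredundant f) :
    Function.Injective f := by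
  intro i j hij
  by_contra hne
  obtain ⟨a, b, h, h'⟩ := hf i
  exact h (by rw [hij]; exact h' j (Ne.symm hne))

/-- Appending an attribute that is not a function of the others splits a class of objects. -/
theorem Irredundant.lt_card_valueVectors [Nonempty A] {f : Fin n → A → Bool}
    (hf : Irredundant f) : n < (valueVectors f).card := by
  induction n with
  | zero =>
    obtain ⟨a⟩ := ‹Nonempty A›
    exact Finset.card_pos.2 ⟨_, mem_valueVectors.2 ⟨a, rfl⟩⟩
  | succ n ih =>
    have h1 := ih (f := fun i => f i.succ) fun i => by
      obtain ⟨a, b, h, h'⟩ := hf i.succ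
      exact ⟨a, b, h, fun j hj => h' _ ((Fin.succ_injective n).ne hj)⟩
    refine Nat.succ_le_of_lt (lt_of_lt_of_le (Nat.succ_lt_succ h1) ?_)
    by_contra! hle
    have hle := Nat.le_of_lt_succ hle
    obtain ⟨a, b, h, h'⟩ := hf 0
    refine h (congrFun (Finset.inj_on_of_surj_on_of_card_le
      (s := valueVectors f) (t := valueVectors fun i => f i.succ)
      (fun v _ i => v i.succ) ?_ ?_ hle (a₁ := fun i => f i a) (a₂ := fun i => f i b)
      (mem_valueVectors.2 ⟨a, rfl⟩) (mem_valueVectors.2 ⟨b, rfl⟩) ?_) 0)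
    · intro v hv
      obtain ⟨a, rfl⟩ := mem_valueVectors.1 hv
      exact mem_valueVectors.2 ⟨a, rfl⟩
    · intro v hv
      obtain ⟨a, rfl⟩ := mem_valueVectors.1 hv
      exact ⟨_, mem_valueVectors.2 ⟨a, rfl⟩, rfl⟩
    · exact funext fun i => h' i.succ (Fin.succ_ne_zero i)

/-- Distinct attributes that are functions of the attributes in `B` correspond to distinct Boolean
functions of `|B|` variables. -/
theorem card_le_of_determined {G B : Finset (A → Bool)}
    (h : ∀ a b, (∀ f ∈ B, f a = f b) → ∀ f ∈ G, f a = f b) : G.card ≤ 2 ^ 2 ^ B.card := by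
  classical
  let Φ : (A → Bool) → (B → Bool) → Bool := fun f p =>
    if hp : ∃ a, ∀ g : B, g.1 a = p g then f hp.choose else false
  have := Finset.card_le_card_of_injOn (s := G) (t := Finset.univ) Φ
    (fun _ _ => Finset.mem_coe.2 (Finset.mem_univ _)) (by
      intro f hf f' hf' hff
      funext a
      have hp : ∃ c, ∀ g : B, g.1 c = (fun g : B => g.1 a) g := ⟨a, fun _ => rfl⟩
      have h1 := congrFun hff fun g : B => g.1 a
      simp only [Φ, dif_pos hp] at h1
      have h2 := h a hp.choose fun g hg => (hp.choose_spec ⟨g, hg⟩).symm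
      rw [h2 f hf, h2 f' hf', h1])
  simpa using this

theorem exists_injective_of_le_card {α : Type*} {s : Finset α} (h : n ≤ s.card) :
    ∃ g : Fin n → α, Function.Injective g ∧ ∀ i, g i ∈ s :=
  ⟨fun i => (s.equivFin.symm (Fin.castLE h i)).1,
    fun _ _ hij => Fin.castLE_injective h (s.equivFin.symm.injective (Subtype.ext hij)),
    fun i => (s.equivFin.symm (Fin.castLE h i)).2⟩

/-- A minimal set of attributes that determines a given large set of attributes is large, and it
is irredundant. -/
theorem exists_irredundant {S : Set (A → Bool)} (hS : S.Infinite) (n : ℕ) :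
    ∃ f : Fin n → A → Bool, (∀ i, f i ∈ S) ∧ Irredundant f := by
  classical
  obtain ⟨G, hGS, hG⟩ := hS.exists_subset_card_eq (2 ^ 2 ^ n)
  let P : Finset (A → Bool) → Prop := fun B =>
    ∀ a b, (∀ f ∈ B, f a = f b) → ∀ f ∈ G, f a = f b
  obtain ⟨B, hB, hmin⟩ := Finset.exists_min_image (G.powerset.filter P) Finset.card
    ⟨G, Finset.mem_filter.2 ⟨Finset.mem_powerset_self G, fun _ _ h => h⟩⟩
  obtain ⟨hBG, hBP⟩ := Finset.mem_filter.1 hB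
  rw [Finset.mem_powerset] at hBG
  have hle : n ≤ B.card := by
    have h := card_le_of_determined hBP
    rw [hG] at h
    exact (Nat.pow_le_pow_iff_right one_lt_two).1 ((Nat.pow_le_pow_iff_right one_lt_two).1 h)
  obtain ⟨g, hg, hgB⟩ := exists_injective_of_le_card hle
  refine ⟨g, fun i => hGS (hBG (hgB i)), fun i => ?_⟩
  by_contra! hi
  have hP : P (B.erase (g i)) := by
    intro a b hab
    refine hBP a b fun f hf => ?_
    by_cases hfi : f = g i
    · subst hfi
      by_contra hne
      obtain ⟨j, hj, hj'⟩ := hi a b hne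
      exact hj' (hab _ (Finset.mem_erase.2 ⟨hg.ne hj, hgB j⟩))
    · exact hab f (Finset.mem_erase.2 ⟨hfi, hf⟩)
  have h1 := hmin _ (Finset.mem_filter.2
    ⟨Finset.mem_powerset.2 ((Finset.erase_subset _ _).trans hBG), hP⟩)
  exact absurd (Finset.card_erase_lt_of_mem (hgB i)) (not_lt.2 h1)

end Families

namespace InfoSystem

variable {U : InfoSystem.{u}} {n : ℕ}

instance : Infinite U.Obj := U.infinite_obj

/-! ### Lower bounds valid for all systems -/

/-- A tree that identifies the value vector of `n` irredundant attributes has `n + 1` decisions at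
terminal nodes, and it queries all `n` attributes. -/
theorem two_mul_succ_le_Lla (U : InfoSystem.{u}) (hn : 1 ≤ n) : 2 * (n + 1) ≤ U.Lla n := by
  classical
  obtain ⟨f, hfS, hf⟩ := exists_irredundant U.infinite_attrs n
  let z := U.identification f hfS
  refine le_trans (Problem.le_Lla (z := z) fun Γ hΓ => ?_) (z.Lla_le hn le_rfl)
  have h := Γ.card_add_card_lt_size (E := Finset.univ.image f)
    (D := (valueVectors f).image z.ν) (fun g hg => ?_) fun d hd => ?_
  · rw [Finset.card_image_of_injective _ hf.injective,
      Finset.card_image_of_injective _ (identification_ν_injective f hfS), Finset.card_univ,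
      Fintype.card_fin] at h
    have := hf.lt_card_valueVectors
    omega
  · obtain ⟨i, -, rfl⟩ := Finset.mem_image.1 hg
    obtain ⟨a, b, hi, hj⟩ := hf i
    obtain ⟨l, d, hp, ha⟩ := hΓ.2.1 a
    exact ⟨l, d, hp, hΓ.exists_mem_eq_attr hp ha i
      (fun h => hi (congrFun (identification_value_inj.1 h) i)) hj⟩
  · obtain ⟨v, hv, rfl⟩ := Finset.mem_image.1 hd
    obtain ⟨a, rfl⟩ := mem_valueVectors.1 hv
    obtain ⟨l, d, hp, ha⟩ := hΓ.2.1 a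
    obtain rfl := hΓ.2.2 a l d hp ha
    exact ⟨l, hp⟩

theorem lt_two_pow_hld (U : InfoSystem.{u}) (hn : 1 ≤ n) : n < 2 ^ U.hld n := by
  classical
  obtain ⟨f, hfS, hf⟩ := exists_irredundant U.infinite_attrs n
  let z := U.identification f hfS
  obtain ⟨Γ, hΓ, hd⟩ : z.hld ∈ {m | ∃ Γ, z.SolvedDet Γ ∧ Γ.depth = m} :=
    Nat.sInf_mem (let ⟨Γ, h, _⟩ := z.exists_solvedDet; ⟨_, Γ, h, rfl⟩)
  refine lt_of_lt_of_le ?_ (Nat.pow_le_pow_right two_pos (z.hld_le hn le_rfl))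
  rw [← hd]
  refine lt_of_lt_of_le ?_ (hΓ.1.card_le (D := (valueVectors f).image z.ν) fun d hd => ?_)
  · rw [Finset.card_image_of_injective _ (identification_ν_injective f hfS)]
    exact hf.lt_card_valueVectors
  · obtain ⟨v, hv, rfl⟩ := Finset.mem_image.1 hd
    obtain ⟨a, rfl⟩ := mem_valueVectors.1 hv
    obtain ⟨l, d, hp, ha⟩ := hΓ.2.2.1 a
    obtain rfl := hΓ.2.2.2 a l d hp ha
    exact ⟨l, hp⟩

/-! ### Infinite independence dimension -/

theorem card_le_iDim {ι : Type*} {s : Finset ι} {f : ι → U.Obj → Bool}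
    (hf : ∀ i ∈ s, f i ∈ U.attrs) (h : ∀ v : ι → Bool, ∃ a, ∀ i ∈ s, f i a = v i) :
    (s.card : ℕ∞) ≤ U.iDim := by
  classical
  have hinj : Set.InjOn f s := by
    intro i hi j hj hij
    by_contra hne
    obtain ⟨a, ha⟩ := h fun t => decide (t = i)
    have h1 := ha i hi
    have h2 := ha j hj
    rw [hij, h2] at h1
    simp [Ne.symm hne] at h1
  rw [← Finset.card_image_of_injOn hinj]
  refine le_iSup₂_of_le (s.image f) ⟨?_, fun δ => ?_⟩ le_rfl
  · intro g hg
    obtain ⟨i, hi, rfl⟩ := Finset.mem_image.1 (Finset.mem_coe.1 hg)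
    exact hf i hi
  · obtain ⟨a, ha⟩ := h fun i => δ (f i)
    exact ⟨a, Finset.forall_mem_image.2 ha⟩

theorem exists_independent_family (h : U.iDim = ⊤) (n : ℕ) :
    ∃ f : Fin n → U.Obj → Bool, (∀ i, f i ∈ U.attrs) ∧ Function.Injective f ∧
      ∀ v : Fin n → Bool, ∃ a, ∀ i, f i a = v i := by
  classical
  obtain ⟨S, hS, hn⟩ : ∃ S, U.Independent S ∧ n ≤ S.card := by
    by_contra! hc
    have : U.iDim ≤ n := iSup₂_le fun S hS => by exact_mod_cast (hc S hS).le
    rw [h, top_le_iff] at this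
    exact ENat.natCast_ne_top n this
  obtain ⟨g, hg, hgS⟩ := exists_injective_of_le_card hn
  refine ⟨g, fun i => hS.1 (hgS i), hg, fun v => ?_⟩
  obtain ⟨a, ha⟩ := hS.2 fun f => if hf : ∃ i, g i = f then v hf.choose else false
  refine ⟨a, fun i => ?_⟩
  have hex : ∃ j, g j = g i := ⟨i, rfl⟩
  rw [ha _ (hgS i), dif_pos hex, hg hex.choose_spec]

theorem two_pow_le_Lla (h : U.iDim = ⊤) (hn : 1 ≤ n) : 2 ^ (n + 1) ≤ U.Lla n := by
  classical
  obtain ⟨f, hfS, hf, hx⟩ := exists_independent_family h n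
  choose x hx using hx
  let z := U.identification f hfS
  refine le_trans (Problem.le_Lla (z := z) fun Γ hΓ => ?_) (z.Lla_le hn le_rfl)
  have hpath : ∀ v, ∃ i : Fin (Γ.k + 1), ∃ l d, (Γ.child i).Path l d ∧ x v ∈ pathSet l ∧
      ∀ j ∈ Finset.univ, ∃ e ∈ l, e.1 = f j := by
    intro v
    obtain ⟨l, d, ⟨i, hp⟩, ha⟩ := hΓ.2.1 (x v)
    refine ⟨i, l, d, hp, ha, fun j _ => ?_⟩
    refine hΓ.exists_mem_eq_attr ⟨i, hp⟩ ha j (b := x (Function.update v j (!v j)))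
      (fun h => ?_) fun t ht => ?_
    · have := congrFun (identification_value_inj.1 h) j
      simp [hx] at this
    · change f t _ = f t _
      simp [hx, ht]
  choose idx hidx using hpath
  have hsum : 2 ^ n = ∑ i, (Finset.univ.filter fun v => idx v = i).card := by
    rw [← Finset.card_eq_sum_card_fiberwise fun v _ => Finset.mem_coe.2 (Finset.mem_univ _)]
    simp
  have hi := Finset.sum_le_sum fun i (_ : i ∈ Finset.univ) =>
    (Γ.child i).two_mul_pow_mul_card_le hx hf Finset.univ
      (Finset.univ.filter fun v => idx v = i)
      (fun v hv => by obtain ⟨-, rfl⟩ := Finset.mem_filter.1 hv; exact hidx v)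
      fun v _ w _ i hi => absurd (Finset.mem_univ i) hi
  rw [Finset.sum_add_distrib, ← Finset.mul_sum, ← Finset.mul_sum, ← hsum, Finset.card_univ,
    Fintype.card_fin] at hi
  rw [DecisionTree.size, pow_succ]
  refine Nat.le_of_mul_le_mul_left ?_ (Nat.two_pow_pos n)
  linarith

/-! ### Systems without the condition of reduction -/

/-- An equivalent subsystem of minimal size of a system is irredundant, and so are its parts. -/
theorem exists_irredundant_equations (h : ¬ U.Reduction) (n : ℕ) :
    ∃ (f : Fin n → U.Obj → Bool) (a : U.Obj), (∀ i, f i ∈ U.attrs) ∧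
      ∀ i, ∃ b, f i a ≠ f i b ∧ ∀ j, j ≠ i → f j a = f j b := by
  classical
  simp only [Reduction, not_exists, not_and] at h
  replace h := h (n + 1) (Nat.le_add_left _ _)
  push Not at h
  obtain ⟨r, f, δ, -, hf, ⟨a, ha⟩, hs⟩ := h
  let P : Finset (Fin r) → Prop := fun s => {a | ∀ i ∈ s, f i a = δ i} = {a | ∀ i, f i a = δ i}
  obtain ⟨s, hsP, hmin⟩ := Finset.exists_min_image (Finset.univ.filter P) Finset.card
    ⟨Finset.univ, by simp [P]⟩
  replace hsP := (Finset.mem_filter.1 hsP).2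
  have hn : n ≤ s.card := by
    by_contra! hlt
    exact hs s (by omega) hsP
  obtain ⟨g, hg, hgs⟩ := exists_injective_of_le_card hn
  refine ⟨fun i => f (g i), a, fun i => hf _, fun i => ?_⟩
  by_contra! hi
  refine absurd (Finset.card_erase_lt_of_mem (hgs i))
    (not_lt.2 (hmin _ (Finset.mem_filter.2 ⟨Finset.mem_univ _, ?_⟩)))
  change _ = _
  rw [← hsP]
  ext b
  refine ⟨fun hb t ht => ?_, fun hb t ht => hb t (Finset.mem_of_mem_erase ht)⟩
  by_cases hti : t = g i
  · subst hti
    by_contra hne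
    obtain ⟨j, hj, hj'⟩ := hi b (by rw [ha]; exact Ne.symm hne)
    exact hj' (by rw [ha, hb _ (Finset.mem_erase.2 ⟨hg.ne hj, hgs j⟩)])
  · exact hb t (Finset.mem_erase.2 ⟨hti, ht⟩)

/-- A path followed by an object that satisfies `n` irredundant equations has to query all of
their attributes. -/
theorem le_hla (h : ¬ U.Reduction) (hn : 1 ≤ n) : n ≤ U.hla n := by
  obtain ⟨f, a, hfS, hb⟩ := exists_irredundant_equations h n
  have hf : Irredundant f := fun i => ⟨a, hb i⟩
  let z := U.identification f hfS
  refine le_trans (Problem.le_hla (z := z) fun Γ hΓ => ?_) (z.hla_le hn le_rfl)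
  obtain ⟨l, d, hp, ha⟩ := hΓ.2.1 a
  refine hp.le_depth hf.injective fun i => ?_
  obtain ⟨b, hi, hj⟩ := hb i
  exact hΓ.exists_mem_eq_attr hp ha i
    (fun h => hi (congrFun (identification_value_inj.1 h) i)) hj

end InfoSystem

/-! ### Building trees -/

/-- For each vector `δ`, compatible or not, some `K` or fewer of the equations `f i (x) = δ i` leave
at most one value vector of the attributes `f i`. -/
def HasCertificates {A : Type u} {n : ℕ} (f : Fin n → A → Bool) (K : ℕ) : Prop :=
  ∀ δ : Fin n → Bool, ∃ s : Finset (Fin n), s.card ≤ K ∧ ∀ a b, (∀ i ∈ s, f i a = δ i) →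
    (∀ i ∈ s, f i b = δ i) → (fun i => f i a) = fun i => f i b

namespace Subtree

variable {A : Type u} {n : ℕ}

/-- Below an edge that is reached by the objects from `B`, the tree `T` computes the function `g`
deterministically, using attributes from `S` only. -/
structure ComputesOn (T : Subtree A) (S : Set (A → Bool)) (g : A → ℕ+) (B : Set A) : Prop where
  labeledIn : T.LabeledIn S
  edgesDistinct : T.EdgesDistinct
  exists_path : ∀ a ∈ B, ∃ l d, T.Path l d ∧ a ∈ pathSet l
  eq_of_path : ∀ a ∈ B, ∀ l d, T.Path l d → a ∈ pathSet l → d = g a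

theorem computesOn_terminal {S : Set (A → Bool)} {g : A → ℕ+} {B : Set A} {d : ℕ+}
    (h : ∀ a ∈ B, g a = d) : (terminal d).ComputesOn S g B where
  labeledIn := trivial
  edgesDistinct := trivial
  exists_path _ _ := ⟨[], d, .terminal d, by simp [pathSet]⟩
  eq_of_path a ha l d' hp _ := by
    cases hp
    exact (h a ha).symm

/-- The tree that queries `f` and continues with `T₀` or `T₁`. -/
def branch (f : A → Bool) (T : Bool → Subtree A) : Subtree A :=
  working f 1 (fun i => i == 1) fun i => T (i == 1)

theorem depth_branch (f : A → Bool) (T : Bool → Subtree A) :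
    (branch f T).depth = 1 + max (T false).depth (T true).depth := by
  simp [branch, depth, Fin.univ_succ]

theorem size_branch (f : A → Bool) (T : Bool → Subtree A) :
    (branch f T).size = 1 + ((T false).size + (T true).size) := by
  simp [branch, size]

theorem computesOn_branch {S : Set (A → Bool)} {g : A → ℕ+} {B : Set A} {f : A → Bool}
    {T : Bool → Subtree A} (hf : f ∈ S) (h : ∀ c, (T c).ComputesOn S g {a ∈ B | f a = c}) :
    (branch f T).ComputesOn S g B where
  labeledIn := ⟨hf, fun i => (h _).labeledIn⟩
  edgesDistinct := by
    refine ⟨fun i j hij => ?_, fun i => (h _).edgesDistinct⟩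
    change Fin 2 at i j
    revert i j
    decide
  exists_path a ha := by
    obtain ⟨l, d, hp, hl⟩ := (h (f a)).exists_path a ⟨ha, rfl⟩
    let i : Fin 2 := if f a then 1 else 0
    have hi : (i == 1) = f a := by
      simp only [i]
      cases f a <;> decide
    refine ⟨_, d, .working _ _ _ _ i l d (by rw [hi]; exact hp), ?_⟩
    rintro e (_ | ⟨_, he⟩)
    · exact hi.symm
    · exact hl e he
  eq_of_path a ha l d hp hl := by
    cases hp with
    | working _ _ _ _ i l _ hp =>
      exact (h _).eq_of_path a ⟨ha, hl (f, i == 1) List.mem_cons_self⟩ l d hp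
        fun e he => hl e (List.mem_cons_of_mem _ he)

/-- If a working node is created only when both values of its attribute occur, then the tree is
binary and its terminal nodes correspond to the value vectors in `V`. -/
theorem exists_computesOn_size_le {f : Fin n → A → Bool} (ν : (Fin n → Bool) → ℕ+)
    (V : Finset (Fin n → Bool)) (hV : V.Nonempty) :
    ∃ T : Subtree A, T.ComputesOn (Set.range f) (fun a => ν fun i => f i a)
      {a | (fun i => f i a) ∈ V} ∧ T.size + 1 ≤ 2 * V.card := by
  classical
  induction hm : V.card using Nat.strong_induction_on generalizing V with
  | _ m ih =>
    subst hm
    by_cases hs : ∃ i, ∀ c, (V.filter fun v => v i = c).Nonempty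
    · obtain ⟨i, hi⟩ := hs
      have hsum : V.card = (V.filter fun v => v i = false).card +
          (V.filter fun v => v i = true).card := by
        rw [← Finset.card_filter_add_card_filter_not (s := V) (fun v => v i = false)]
        simp
      have hpos := fun c => Finset.card_pos.2 (hi c)
      have h0 := hpos false
      have h1 := hpos true
      have hT : ∀ c, ∃ T : Subtree A, T.ComputesOn (Set.range f) (fun a => ν fun i => f i a)
          {a | (fun i => f i a) ∈ V.filter fun v => v i = c} ∧
          T.size + 1 ≤ 2 * (V.filter fun v => v i = c).card :=
        fun c => ih _ (by cases c <;> omega) _ (hi c) rfl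
      choose T hT hsize using hT
      refine ⟨branch (f i) T, computesOn_branch ⟨i, rfl⟩ fun c => ?_, ?_⟩
      · simpa only [Finset.mem_filter, Set.mem_ofPred_eq] using hT c
      · rw [size_branch]
        have := hsize false
        have := hsize true
        omega
    · obtain ⟨w, hw⟩ := hV
      refine ⟨terminal (ν w), computesOn_terminal fun a ha => congrArg ν ?_, ?_⟩
      · funext i
        by_contra hne
        refine hs ⟨i, fun c => ?_⟩
        by_cases hc : w i = c
        · exact ⟨w, Finset.mem_filter.2 ⟨hw, hc⟩⟩
        · refine ⟨_, Finset.mem_filter.2 ⟨ha, ?_⟩⟩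
          revert hne hc
          cases f i a <;> cases w i <;> cases c <;> simp
      · have := Finset.card_pos.2 ⟨w, hw⟩
        simp only [size]
        omega

/-- Query the attributes with indices in `s`. If some answer differs from the vector `δ`, continue
with a tree of depth at most `h`; if all agree with `δ`, then the value vector is known. -/
theorem exists_computesOn_query {f : Fin n → A → Bool} {ν : (Fin n → Bool) → ℕ+}
    {δ : Fin n → Bool} {h t : ℕ} (ih : ∀ V : Finset (Fin n → Bool), V.card < t →
      ∃ T : Subtree A, T.ComputesOn (Set.range f) (fun a => ν fun i => f i a)
        {a | (fun i => f i a) ∈ V} ∧ T.depth ≤ h)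
    (s : Finset (Fin n)) (V : Finset (Fin n → Bool))
    (hs : ∀ i ∈ s, (V.filter fun v => v i = !δ i).card < t)
    (hV : ∀ a b, (fun i => f i a) ∈ V → (fun i => f i b) ∈ V → (∀ i ∈ s, f i a = δ i) →
      (∀ i ∈ s, f i b = δ i) → (fun i => f i a) = fun i => f i b) :
    ∃ T : Subtree A, T.ComputesOn (Set.range f) (fun a => ν fun i => f i a)
      {a | (fun i => f i a) ∈ V} ∧ T.depth ≤ h + s.card := by
  classical
  induction s using Finset.induction_on generalizing V with
  | empty =>
    by_cases hne : ∃ b, (fun i => f i b) ∈ V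
    · obtain ⟨b, hb⟩ := hne
      exact ⟨terminal (ν fun i => f i b), computesOn_terminal fun a ha =>
        congrArg ν (hV a b ha hb (by simp) (by simp)), by simp [depth]⟩
    · exact ⟨terminal 1, computesOn_terminal fun a ha => absurd ⟨a, ha⟩ hne, by simp [depth]⟩
  | insert i s his ihs =>
    obtain ⟨T₀, hT₀, hd₀⟩ := ih _ (hs i (Finset.mem_insert_self i s))
    obtain ⟨T₁, hT₁, hd₁⟩ := ihs (V.filter fun v => v i = δ i)
      (fun j hj => (Finset.card_le_card (Finset.filter_subset_filter _
        (Finset.filter_subset _ _))).trans_lt (hs j (Finset.mem_insert_of_mem hj)))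
      (fun a b ha hb ha' hb' => by
        obtain ⟨ha, hai⟩ := Finset.mem_filter.1 ha
        obtain ⟨hb, hbi⟩ := Finset.mem_filter.1 hb
        exact hV a b ha hb (Finset.forall_mem_insert .. |>.2 ⟨hai, ha'⟩)
          (Finset.forall_mem_insert .. |>.2 ⟨hbi, hb'⟩))
    refine ⟨branch (f i) fun c => if c = δ i then T₁ else T₀,
      computesOn_branch ⟨i, rfl⟩ fun c => ?_, ?_⟩
    · by_cases hc : c = δ i
      · subst hc
        simpa only [Finset.mem_filter, Set.mem_ofPred_eq, if_true] using hT₁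
      · obtain rfl : c = !δ i := by revert hc; cases c <;> cases δ i <;> simp
        simpa only [Finset.mem_filter, Set.mem_ofPred_eq, if_neg hc] using hT₀
    · rw [depth_branch, Finset.card_insert_of_notMem his]
      cases δ i <;> simp <;> omega

/-- For the vector `δ` of the majority values of the attributes on `V`, querying at most `K`
attributes either determines the value vector or excludes at least half of `V`. -/
theorem exists_computesOn_depth_le {f : Fin n → A → Bool} {ν : (Fin n → Bool) → ℕ+} {K : ℕ}
    (hK : HasCertificates f K) (t : ℕ) (V : Finset (Fin n → Bool))
    (hV : V.card < 2 ^ t) :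
    ∃ T : Subtree A, T.ComputesOn (Set.range f) (fun a => ν fun i => f i a)
      {a | (fun i => f i a) ∈ V} ∧ T.depth ≤ K * t := by
  classical
  induction t generalizing V with
  | zero =>
    obtain rfl : V = ∅ := by simpa using hV
    exact ⟨terminal 1, computesOn_terminal fun a ha => by simp at ha, by simp [depth]⟩
  | succ t ih =>
    have hmaj : ∀ i, ∃ c, (V.filter fun v => v i = !c).card < 2 ^ t := by
      intro i
      by_contra! hc
      have h0 := hc false
      have h1 := hc true
      have hsum := Finset.card_filter_add_card_filter_not (s := V) (fun v => v i = false)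
      simp only [Bool.not_false, Bool.not_true, Bool.not_eq_false] at h0 h1 hsum
      rw [pow_succ] at hV
      omega
    choose δ hδ using hmaj
    obtain ⟨s, hs, hs'⟩ := hK δ
    obtain ⟨T, hT, hd⟩ := exists_computesOn_query ih s V (fun i _ => hδ i)
      fun a b _ _ => hs' a b
    refine ⟨T, hT, hd.trans ?_⟩
    rw [mul_add, mul_one]
    omega

/-- The tree that consists of one path. -/
def chain : List ((A → Bool) × Bool) → ℕ+ → Subtree A
  | [], d => terminal d
  | e :: l, d => working e.1 0 (fun _ => e.2) fun _ => chain l d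

theorem depth_chain (l : List ((A → Bool) × Bool)) (d : ℕ+) : (chain l d).depth = l.length := by
  induction l with
  | nil => rfl
  | cons e l ih => simp [chain, depth, ih, add_comm]

theorem labeledIn_chain {S : Set (A → Bool)} {l : List ((A → Bool) × Bool)} (d : ℕ+)
    (h : ∀ e ∈ l, e.1 ∈ S) : (chain l d).LabeledIn S := by
  induction l with
  | nil => trivial
  | cons e l ih =>
    exact ⟨h e List.mem_cons_self, fun _ => ih fun e he => h e (List.mem_cons_of_mem _ he)⟩

theorem path_chain (l : List ((A → Bool) × Bool)) (d : ℕ+) : (chain l d).Path l d := by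
  induction l with
  | nil => exact .terminal d
  | cons e l ih => exact .working _ _ _ _ 0 l d ih

theorem eq_of_path_chain {l l' : List ((A → Bool) × Bool)} {d d' : ℕ+}
    (h : (chain l d).Path l' d') : l' = l ∧ d' = d := by
  induction l generalizing l' with
  | nil => cases h; exact ⟨rfl, rfl⟩
  | cons e l ih =>
    rw [chain] at h
    cases h with
    | working _ _ _ _ i l' _ h =>
      obtain ⟨rfl, rfl⟩ := ih h
      exact ⟨rfl, rfl⟩

end Subtree

namespace Problem

variable {U : InfoSystem.{u}} {n : ℕ} (z : Problem U n)

theorem solvedDet_of_computesOn {T : Subtree U.Obj} {V : Finset (Fin n → Bool)}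
    (hV : ∀ a, (fun i => z.attr i a) ∈ V)
    (h : T.ComputesOn (Set.range z.attr) (fun a => z.ν fun i => z.attr i a)
      {a | (fun i => z.attr i a) ∈ V}) : z.SolvedDet ⟨0, fun _ => T⟩ := by
  refine ⟨⟨rfl, fun _ => h.edgesDistinct⟩, fun _ => h.labeledIn, fun a => ?_, ?_⟩
  · obtain ⟨l, d, hp, ha⟩ := h.exists_path a (hV a)
    exact ⟨l, d, ⟨0, hp⟩, ha⟩
  · rintro a l d ⟨_, hp⟩ ha
    exact h.eq_of_path a (hV a) l d hp ha

theorem Lld_le_card_valueVectors : z.Lld ≤ 2 * (valueVectors z.attr).card := by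
  have hmem : ∀ a, (fun i => z.attr i a) ∈ valueVectors z.attr :=
    fun a => mem_valueVectors.2 ⟨a, rfl⟩
  obtain ⟨T, hT, hs⟩ := Subtree.exists_computesOn_size_le (f := z.attr) z.ν (valueVectors z.attr)
    ⟨_, hmem (Classical.arbitrary U.Obj)⟩
  refine (z.solvedDet_of_computesOn hmem hT).Lld_le.trans ?_
  simp only [DecisionTree.size, Fin.sum_const, zero_add, one_smul]
  omega

theorem hld_le_mul {K t : ℕ}
    (hK : HasCertificates z.attr K)
    (ht : (valueVectors z.attr).card < 2 ^ t) : z.hld ≤ K * t := by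
  obtain ⟨T, hT, hs⟩ := Subtree.exists_computesOn_depth_le (ν := z.ν) hK t _ ht
  refine (z.solvedDet_of_computesOn
    (fun a => mem_valueVectors.2 ⟨a, rfl⟩) hT).hld_le.trans ?_
  simpa [DecisionTree.depth] using hs

/-- A root with one path for each value vector, which queries the equations that determine it. -/
theorem hla_le_of_certificates {K : ℕ}
    (hK : HasCertificates z.attr K) : z.hla ≤ K := by
  classical
  choose s hs hs' using hK
  let W := valueVectors z.attr
  obtain ⟨k, hk⟩ : ∃ k, W.card = k + 1 := Nat.exists_eq_succ_of_ne_zero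
    (Finset.card_pos.2 ⟨_, mem_valueVectors.2 ⟨Classical.arbitrary U.Obj, rfl⟩⟩).ne'
  let e := W.equivFinOfCardEq hk
  let L : (Fin n → Bool) → List ((U.Obj → Bool) × Bool) := fun v =>
    (s v).toList.map fun i => (z.attr i, v i)
  have hL : ∀ v a, a ∈ pathSet (L v) ↔ ∀ i ∈ s v, z.attr i a = v i := by
    intro v a
    simp [L, pathSet]
  let Γ : DecisionTree U.Obj := ⟨k, fun i => Subtree.chain (L (e.symm i)) (z.ν (e.symm i))⟩
  have hΓ : z.SolvedNondet Γ := by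
    refine ⟨fun i => Subtree.labeledIn_chain _ fun p hp => ?_, fun a => ?_, ?_⟩
    · obtain ⟨j, -, rfl⟩ := List.mem_map.1 hp
      exact ⟨j, rfl⟩
    · let w : W := ⟨_, mem_valueVectors.2 ⟨a, rfl⟩⟩
      refine ⟨_, _, ⟨e w, Subtree.path_chain _ _⟩, ?_⟩
      rw [e.symm_apply_apply, hL]
      exact fun _ _ => rfl
    · rintro a l d ⟨i, hp⟩ ha
      obtain ⟨rfl, rfl⟩ := Subtree.eq_of_path_chain hp
      rw [hL] at ha
      obtain ⟨b, hb⟩ := mem_valueVectors.1 (e.symm i).2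
      have := hs' _ b a (fun j _ => congrFun hb j) ha
      rw [← hb, this]
      rfl
  refine hΓ.hla_le.trans (Finset.sup_le fun i _ => ?_)
  change (Subtree.chain _ _).depth ≤ K
  rw [Subtree.depth_chain, List.length_map, Finset.length_toList]
  exact hs _

end Problem

namespace InfoSystem

variable {U : InfoSystem.{u}} {n : ℕ}

/-! ### Finite independence dimension -/

/-- The Sauer–Shelah bound: an index set shattered by the value vectors is an independent set of
attributes. -/
theorem card_valueVectors_le {d : ℕ} (hd : U.iDim = d) {f : Fin n → U.Obj → Bool}
    (hf : ∀ i, f i ∈ U.attrs) (hn : 1 ≤ n) : (valueVectors f).card ≤ (4 * n) ^ d := by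
  classical
  let 𝒜 : Finset (Finset (Fin n)) :=
    (valueVectors f).image fun v => Finset.univ.filter fun i => v i = true
  have hcard : 𝒜.card = (valueVectors f).card := Finset.card_image_of_injective _ (by
    intro v w h
    funext i
    have := Finset.ext_iff.1 h i
    simp only [Finset.mem_filter, Finset.mem_univ, true_and] at this
    exact Bool.eq_iff_iff.2 this)
  have hvc : 𝒜.vcDim ≤ d := by
    refine Finset.sup_le fun s hs => ?_
    rw [Finset.mem_shatterer] at hs
    have := card_le_iDim (s := s) (f := f) (fun i _ => hf i) fun v => by
      obtain ⟨u, hu, huv⟩ := hs (Finset.filter_subset (fun i => v i = true) s)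
      obtain ⟨w, hw, rfl⟩ := Finset.mem_image.1 hu
      obtain ⟨a, rfl⟩ := mem_valueVectors.1 hw
      refine ⟨a, fun i hi => ?_⟩
      have := Finset.ext_iff.1 huv i
      simp only [Finset.mem_inter, Finset.mem_filter, Finset.mem_univ, true_and, hi] at this
      exact Bool.eq_iff_iff.2 this
    rw [hd] at this
    exact_mod_cast this
  rw [← hcard]
  calc 𝒜.card ≤ 𝒜.shatterer.card := Finset.card_le_card_shatterer 𝒜
    _ ≤ ∑ k ∈ Finset.Iic 𝒜.vcDim, (Fintype.card (Fin n)).choose k :=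
        Finset.card_shatterer_le_sum_vcDim
    _ ≤ ∑ k ∈ Finset.Iic d, n ^ d := by
        rw [Fintype.card_fin]
        refine (Finset.sum_le_sum_of_subset (Finset.Iic_subset_Iic.2 hvc)).trans
          (Finset.sum_le_sum fun k hk => (Nat.choose_le_pow n k).trans ?_)
        exact Nat.pow_le_pow_right hn (Finset.mem_Iic.1 hk)
    _ = (d + 1) * n ^ d := by simp
    _ ≤ 4 ^ d * n ^ d := by
        refine Nat.mul_le_mul_right _ ((Nat.lt_pow_self (by norm_num : 1 < 4)))
    _ = (4 * n) ^ d := (mul_pow _ _ _).symm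

theorem Lld_le_of_iDim {d : ℕ} (hd : U.iDim = d) (n : ℕ) : U.Lld n ≤ 2 * (4 * n) ^ d :=
  csSup_le' (by
    rintro _ ⟨k, h1, hk, z, rfl⟩
    refine z.Lld_le_card_valueVectors.trans (Nat.mul_le_mul_left 2 ?_)
    exact (card_valueVectors_le hd z.attr_mem h1).trans (Nat.pow_le_pow_left (by omega) d))

/-! ### Systems with the condition of reduction -/

/-- The condition of reduction provides certificates of bounded size. For a compatible system this
is the condition itself; for an incompatible one, let `s` be a minimal incompatible subsystem.
Without one of its equations it is compatible, hence equivalent to at most `m` of its equations;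
together with the removed equation these are incompatible. -/
theorem exists_certificates (h : U.Reduction) : ∃ K : ℕ, ∀ (n : ℕ) (f : Fin n → U.Obj → Bool),
    (∀ i, f i ∈ U.attrs) → HasCertificates f K := by
  classical
  obtain ⟨m, -, hm⟩ := h
  refine ⟨m + 1, fun n f hf δ => ?_⟩
  have hsub : ∀ s : Finset (Fin n), (∃ a, ∀ i ∈ s, f i a = δ i) →
      ∃ t : Finset (Fin n), t.card ≤ m ∧ ∀ a, (∀ i ∈ t, f i a = δ i) → ∀ i ∈ s, f i a = δ i := by
    rintro s ⟨a, ha⟩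
    rcases s.eq_empty_or_nonempty with rfl | ⟨i₀, hi₀⟩
    · exact ⟨∅, by simp, by simp⟩
    -- The system indexed by `s` is reindexed by `Fin n`, with repetitions of one equation.
    let g : Fin n → Fin n := fun i => if i ∈ s then i else i₀
    have hg : ∀ i, g i ∈ s := fun i => by simp only [g]; split_ifs <;> assumption
    obtain ⟨t, ht, hts⟩ := hm n (fun i => f (g i)) (fun i => δ (g i)) (Fin.pos i₀)
      (fun i => hf _) ⟨a, fun i => ha _ (hg i)⟩
    refine ⟨t.image g, Finset.card_image_le.trans ht, fun b hb i hi => ?_⟩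
    have h1 : b ∈ {a | ∀ i ∈ t, f (g i) a = δ (g i)} := Finset.forall_mem_image.1 hb
    rw [hts] at h1
    simpa only [g, if_pos hi] using h1 i
  by_cases hc : ∃ a, ∀ i ∈ Finset.univ, f i a = δ i
  · obtain ⟨t, ht, hts⟩ := hsub _ hc
    refine ⟨t, ht.trans (Nat.le_succ m), fun a b ha hb => funext fun i => ?_⟩
    rw [hts a ha i (Finset.mem_univ i), hts b hb i (Finset.mem_univ i)]
  · obtain ⟨s, hs, hmin⟩ := Finset.exists_min_image
      (Finset.univ.filter fun s : Finset (Fin n) => ¬ ∃ a, ∀ i ∈ s, f i a = δ i) Finset.card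
      ⟨Finset.univ, Finset.mem_filter.2 ⟨Finset.mem_univ _, hc⟩⟩
    replace hs := (Finset.mem_filter.1 hs).2
    obtain ⟨i, hi⟩ : s.Nonempty := by
      rw [Finset.nonempty_iff_ne_empty]
      rintro rfl
      exact hs ⟨Classical.arbitrary U.Obj, by simp⟩
    obtain ⟨t, ht, hts⟩ := hsub (s.erase i) (by
      by_contra hne
      exact absurd (Finset.card_erase_lt_of_mem hi)
        (not_lt.2 (hmin _ (Finset.mem_filter.2 ⟨Finset.mem_univ _, hne⟩))))
    refine ⟨insert i t, (Finset.card_insert_le _ _).trans (Nat.succ_le_succ ht),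
      fun a b ha hb => absurd ⟨a, fun j hj => ?_⟩ hs⟩
    by_cases hji : j = i
    · exact ha j (hji ▸ Finset.mem_insert_self i t)
    · exact hts a (fun k hk => ha k (Finset.mem_insert_of_mem hk)) j
        (Finset.mem_erase.2 ⟨hji, hj⟩)

theorem iDim_ne_top_of_reduction (h : U.Reduction) : U.iDim ≠ ⊤ := by
  intro htop
  obtain ⟨K, hK⟩ := exists_certificates h
  obtain ⟨f, hfS, -, hf⟩ := exists_independent_family htop (K + 1)
  obtain ⟨s, hs, hs'⟩ := hK _ f hfS fun _ => false
  obtain ⟨i, hi⟩ : ∃ i, i ∉ s := by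
    by_contra! hc
    have := Finset.card_le_card (fun i _ => hc i : Finset.univ ⊆ s)
    rw [Finset.card_univ, Fintype.card_fin] at this
    omega
  obtain ⟨a, ha⟩ := hf fun _ => false
  obtain ⟨b, hb⟩ := hf fun j => decide (j = i)
  have := congrFun (hs' a b (fun j _ => ha j) fun j hj => by
    rw [hb]
    exact decide_eq_false fun h => hi (h ▸ hj)) i
  simp [ha, hb] at this

theorem exists_hla_le (h : U.Reduction) : ∃ K, ∀ n, U.hla n ≤ K := by
  obtain ⟨K, hK⟩ := exists_certificates h
  refine ⟨K, fun n => csSup_le' ?_⟩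
  rintro _ ⟨k, -, -, z, rfl⟩
  exact z.hla_le_of_certificates (hK k z.attr z.attr_mem)

theorem exists_hld_le (h : U.Reduction) :
    ∃ K d : ℕ, ∀ n, U.hld n ≤ K * (Nat.log 2 ((4 * n) ^ d) + 1) := by
  obtain ⟨K, hK⟩ := exists_certificates h
  obtain ⟨d, hd⟩ := ENat.ne_top_iff_exists.1 (iDim_ne_top_of_reduction h)
  refine ⟨K, d, fun n => csSup_le' ?_⟩
  rintro _ ⟨k, h1, hk, z, rfl⟩
  refine z.hld_le_mul (hK k z.attr z.attr_mem) ?_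
  refine lt_of_le_of_lt ?_ (Nat.lt_pow_succ_log_self one_lt_two _)
  exact (card_valueVectors_le hd.symm z.attr_mem h1).trans (Nat.pow_le_pow_left (by omega) d)

end InfoSystem

/-! ### Types of behavior exclude each other -/

theorem isLittleO_log_natCast : (fun n : ℕ => Real.log n) =o[atTop] fun n : ℕ => (n : ℝ) :=
  Real.isLittleO_log_id_atTop.comp_tendsto tendsto_natCast_atTop_atTop

theorem tendsto_log_natCast : Tendsto (fun n : ℕ => Real.log n) atTop atTop :=
  Real.tendsto_log_atTop.comp tendsto_natCast_atTop_atTop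

theorem isBigO_one_log_natCast : (fun _ : ℕ => (1 : ℝ)) =O[atTop] fun n : ℕ => Real.log n :=
  ((isLittleO_const_left).2 (Or.inr (tendsto_norm_atTop_atTop.comp tendsto_log_natCast))).isBigO

theorem not_isBigO_log_of_le {g : ℕ → ℕ} (hg : ∀ n, 1 ≤ n → n ≤ g n) :
    ¬ (fun n => (g n : ℝ)) =O[atTop] fun n : ℕ => Real.log n := by
  intro h
  have h1 : (fun n : ℕ => (n : ℝ)) =O[atTop] fun n => (g n : ℝ) := by
    refine IsBigO.of_bound 1 ((eventually_ge_atTop 1).mono fun n hn => ?_)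
    simpa using hg n hn
  refine isLittleO_irrefl ?_ ((h1.trans h).trans_isLittleO isLittleO_log_natCast)
  exact ((eventually_ge_atTop 1).mono fun n hn =>
    Nat.cast_ne_zero.2 (Nat.one_le_iff_ne_zero.1 hn)).frequently

theorem exists_mul_pow_lt_two_pow (d : ℕ) : ∃ n : ℕ, 1 ≤ n ∧ 2 * (4 * n) ^ d < 2 ^ (n + 1) := by
  have h := (isLittleO_pow_const_const_pow_of_one_lt (R := ℝ) d one_lt_two).bound
    (show (0 : ℝ) < (4 ^ d)⁻¹ / 2 by positivity)
  obtain ⟨n, hn, hn1⟩ := (h.and (eventually_ge_atTop 1)).exists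
  refine ⟨n, hn1, ?_⟩
  have h2 : (0 : ℝ) < 2 ^ n := by positivity
  have h4 : (0 : ℝ) < 4 ^ d := by positivity
  rw [Real.norm_of_nonneg (by positivity), Real.norm_of_nonneg h2.le] at hn
  have h3 : (4 : ℝ) ^ d * n ^ d ≤ 2 ^ n / 2 := by
    calc (4 : ℝ) ^ d * n ^ d ≤ 4 ^ d * ((4 ^ d)⁻¹ / 2 * 2 ^ n) := by gcongr
      _ = 2 ^ n / 2 := by field_simp
  have : (2 : ℝ) * (4 * n) ^ d < 2 ^ (n + 1) := by
    rw [mul_pow, pow_succ]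
    linarith
  exact_mod_cast this

namespace InfoSystem

variable {U : InfoSystem.{u}}

theorem HasBehavior.unique {g : ℕ → ℕ} {s t : Behavior} (hs : U.HasBehavior g s)
    (ht : U.HasBehavior g t) : s = t := by
  -- A bounded function and a logarithmic function are `O(log n)`; the others are at least `n`.
  have hlog : U.HasBehavior g .CON ∨ U.HasBehavior g .LOG →
      (fun n => (g n : ℝ)) =O[atTop] fun n : ℕ => Real.log n := by
    rintro (h | h)
    · exact IsBigO.trans h isBigO_one_log_natCast
    · exact IsTheta.isBigO h
  have hlin : U.HasBehavior g .LIN ∨ U.HasBehavior g .POL ∨ U.HasBehavior g .EXP →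
      ∀ n, 1 ≤ n → n ≤ g n := by
    rintro (h | ⟨d, -, h⟩ | h) n hn
    · exact (h n hn).ge
    · have := (h n hn).1
      omega
    · rw [h n hn]
      exact (Nat.le_succ n).trans Nat.lt_two_pow_self.le
  have hloglin := fun h h' => not_isBigO_log_of_le (hlin h) (hlog h')
  have hconlog : U.HasBehavior g .CON → ¬ U.HasBehavior g .LOG := fun h h' =>
    not_isBoundedUnder_of_tendsto_atTop (tendsto_norm_atTop_atTop.comp tendsto_log_natCast)
      ((IsTheta.isBigO_symm h').trans h).isBoundedUnder_le
  have hpolexp : U.HasBehavior g .POL → ¬ U.HasBehavior g .EXP := by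
    rintro ⟨d, -, h⟩ h'
    obtain ⟨n, hn, hlt⟩ := exists_mul_pow_lt_two_pow d
    rw [← h' n hn] at hlt
    exact absurd (h n hn).2 (not_le.2 hlt)
  have hlinpol : U.HasBehavior g .LIN → ¬ U.HasBehavior g .POL := by
    rintro h' ⟨d, -, h⟩
    have := (h 1 le_rfl).1
    rw [h' 1 le_rfl] at this
    omega
  have hlinexp : U.HasBehavior g .LIN → ¬ U.HasBehavior g .EXP := fun h' h => by
    have := h 1 le_rfl
    rw [h' 1 le_rfl] at this
    omega
  clear hlog hlin
  cases s <;> cases t <;> first | rfl | (exfalso; tauto)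

theorem HasLocalType.unique {s t : LocalType} (hs : U.HasLocalType s) (ht : U.HasLocalType t) :
    s = t :=
  LocalType.ext (hs.1.unique ht.1) (hs.2.1.unique ht.2.1) (hs.2.2.1.unique ht.2.2.1)
    (hs.2.2.2.unique ht.2.2.2)

/-! ### The three local types -/

theorem hasBehavior_POL (h : U.iDim ≠ ⊤) :
    U.HasBehavior U.Lld .POL ∧ U.HasBehavior U.Lla .POL := by
  obtain ⟨d, hd⟩ := ENat.ne_top_iff_exists.1 h
  exact ⟨⟨d, hd.symm, fun n hn => ⟨(U.two_mul_succ_le_Lla hn).trans (U.Lla_le_Lld n),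
    Lld_le_of_iDim hd.symm n⟩⟩, ⟨d, hd.symm, fun n hn => ⟨U.two_mul_succ_le_Lla hn,
    (U.Lla_le_Lld n).trans (Lld_le_of_iDim hd.symm n)⟩⟩⟩

theorem hasBehavior_LIN (h : ∀ n, 1 ≤ n → n ≤ U.hla n) :
    U.HasBehavior U.hld .LIN ∧ U.HasBehavior U.hla .LIN :=
  ⟨fun n hn => le_antisymm (U.hld_le n) ((h n hn).trans (U.hla_le_hld n)),
    fun n hn => le_antisymm ((U.hla_le_hld n).trans (U.hld_le n)) (h n hn)⟩

theorem hasBehavior_hld_LOG (h : U.Reduction) : U.HasBehavior U.hld .LOG := by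
  constructor
  · obtain ⟨K, d, hK⟩ := exists_hld_le h
    refine IsBigO.of_bound (K * (2 * d + 1) / Real.log 2) ((eventually_ge_atTop 4).mono
      fun n hn => ?_)
    have hn' : (4 : ℝ) ≤ n := by exact_mod_cast hn
    have h2 : 0 < Real.log 2 := Real.log_pos one_lt_two
    have hlog : Real.log 2 ≤ Real.log n := Real.log_le_log two_pos (by linarith)
    have h1 : Nat.log 2 ((4 * n) ^ d) ≤ Nat.log 2 (n ^ (2 * d)) := by
      refine Nat.log_mono_right ?_
      rw [pow_mul]
      exact Nat.pow_le_pow_left (by nlinarith) d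
    have h3 : (Nat.log 2 (n ^ (2 * d)) : ℝ) ≤ 2 * d * Real.log n / Real.log 2 := by
      have := Real.natLog_le_logb (n ^ (2 * d)) 2
      rw [Real.logb] at this
      push_cast [Real.log_pow] at this
      exact this
    have h4 : (1 : ℝ) ≤ Real.log n / Real.log 2 := (one_le_div h2).2 hlog
    rw [Real.norm_of_nonneg (Nat.cast_nonneg _), Real.norm_of_nonneg (h2.le.trans hlog)]
    calc (U.hld n : ℝ) ≤ K * (Nat.log 2 ((4 * n) ^ d) + 1) := by exact_mod_cast hK n
      _ ≤ K * (2 * d * Real.log n / Real.log 2 + Real.log n / Real.log 2) := by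
          have : (Nat.log 2 ((4 * n) ^ d) : ℝ) ≤ Nat.log 2 (n ^ (2 * d)) := by exact_mod_cast h1
          gcongr
          exact this.trans h3
      _ = K * (2 * d + 1) / Real.log 2 * Real.log n := by ring
  · refine IsBigO.of_bound 1 ((eventually_ge_atTop 1).mono fun n hn => ?_)
    have hn' : (1 : ℝ) ≤ n := by exact_mod_cast hn
    rw [Real.norm_of_nonneg (Nat.cast_nonneg _), Real.norm_of_nonneg (Real.log_nonneg hn'), one_mul]
    have h1 : (n : ℝ) ≤ 2 ^ U.hld n := by exact_mod_cast (U.lt_two_pow_hld hn).le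
    calc Real.log n ≤ Real.log (2 ^ U.hld n) := Real.log_le_log (by linarith) h1
      _ = U.hld n * Real.log 2 := Real.log_pow _ _
      _ ≤ U.hld n * 1 := by
          gcongr
          linarith [Real.log_two_lt_d9]
      _ = U.hld n := mul_one _

theorem hasLocalType_row1 (h : U.Reduction) : U.HasLocalType row1 := by
  refine ⟨hasBehavior_hld_LOG h, ?_, hasBehavior_POL (iDim_ne_top_of_reduction h)⟩
  obtain ⟨K, hK⟩ := exists_hla_le h
  refine IsBigO.of_bound K (Eventually.of_forall fun n => ?_)
  simpa using hK n

theorem hasLocalType_row2 (h : ¬ U.Reduction) (h' : U.iDim ≠ ⊤) : U.HasLocalType row2 :=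
  ⟨(hasBehavior_LIN fun _ => le_hla h).1, (hasBehavior_LIN fun _ => le_hla h).2,
    hasBehavior_POL h'⟩

theorem hasLocalType_row3 (h : U.iDim = ⊤) : U.HasLocalType row3 := by
  have hlin := hasBehavior_LIN fun _ => le_hla fun hr : U.Reduction =>
    iDim_ne_top_of_reduction hr h
  exact ⟨hlin.1, hlin.2,
    fun n hn => le_antisymm (U.Lld_le n) ((two_pow_le_Lla h hn).trans (U.Lla_le_Lld n)),
    fun n hn => le_antisymm ((U.Lla_le_Lld n).trans (U.Lld_le n)) (two_pow_le_Lla h hn)⟩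

end InfoSystem

/-! ### The three explicit systems -/

/-- A compatible system of threshold equations describes an interval: only its greatest lower bound
and its least upper bound matter. -/
theorem thresholdSystem_reduction : thresholdSystem.Reduction := by
  refine ⟨2, one_le_two, fun r f δ hr hf _ => ?_⟩
  choose t ht using hf
  have hbound : ∀ c, ∃ s : Finset (Fin r), s.card ≤ 1 ∧
      ∀ a, (∀ i ∈ s, f i a = δ i) → ∀ i, δ i = c → f i a = δ i := by
    intro c
    rcases (Finset.univ.filter fun i => δ i = c).eq_empty_or_nonempty with he | hne
    · exact ⟨∅, by simp, fun a _ i hi => absurd hi (Finset.filter_eq_empty_iff.1 he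
        (Finset.mem_univ i))⟩
    · cases c
      · obtain ⟨j, hj, hmin⟩ := Finset.exists_min_image _ t hne
        refine ⟨{j}, by simp, fun (a : ℕ+) ha i hi => ?_⟩
        have h1 := ha j (Finset.mem_singleton_self j)
        have h2 := hmin i (Finset.mem_filter.2 ⟨Finset.mem_univ i, hi⟩)
        rw [(Finset.mem_filter.1 hj).2, ← ht j] at h1
        rw [hi, ← ht i]
        exact decide_eq_false (not_lt.2 ((not_lt.1 (of_decide_eq_false h1)).trans h2))
      · obtain ⟨j, hj, hmax⟩ := Finset.exists_max_image _ t hne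
        refine ⟨{j}, by simp, fun (a : ℕ+) ha i hi => ?_⟩
        have h1 := ha j (Finset.mem_singleton_self j)
        have h2 := hmax i (Finset.mem_filter.2 ⟨Finset.mem_univ i, hi⟩)
        rw [(Finset.mem_filter.1 hj).2, ← ht j] at h1
        rw [hi, ← ht i]
        exact decide_eq_true (lt_of_le_of_lt h2 (of_decide_eq_true h1))
  obtain ⟨s, hs, hs'⟩ := hbound false
  obtain ⟨s', hc, hc'⟩ := hbound true
  refine ⟨s ∪ s', (Finset.card_union_le s s').trans (by omega), ?_⟩
  ext a
  refine ⟨fun ha i => ?_, fun ha i _ => ha i⟩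
  cases hi : δ i
  · rw [← hi]
    exact hs' a (fun j hj => ha j (Finset.mem_union_left _ hj)) i hi
  · rw [← hi]
    exact hc' a (fun j hj => ha j (Finset.mem_union_right _ hj)) i hi

/-- In the system `p₁(x) = 0, …, p_r(x) = 0` no equation follows from the others. -/
theorem not_pointSystem_reduction : ¬ pointSystem.Reduction := by
  rintro ⟨m, -, hm⟩
  obtain ⟨s, hs, h⟩ := hm (m + 1) (fun i => pointAttr (Nat.succPNat i)) (fun _ => false)
    (Nat.le_add_left _ _) (fun i => ⟨_, rfl⟩)
    ⟨Nat.succPNat (m + 1), fun i => decide_eq_false fun h => by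
      have := Nat.succPNat_injective h
      omega⟩
  obtain ⟨i, hi⟩ : ∃ i, i ∉ s := by
    by_contra! hc
    have := Finset.card_le_card (fun i _ => hc i : Finset.univ ⊆ s)
    rw [Finset.card_univ, Fintype.card_fin] at this
    omega
  have h1 : Nat.succPNat i ∈ {a | ∀ j ∈ s, pointAttr (Nat.succPNat (j : Fin (m + 1))) a = false} :=
    fun j hj => decide_eq_false fun h => hi (Fin.ext (Nat.succPNat_injective h) ▸ hj)
  have h2 := (Set.ext_iff.1 h (Nat.succPNat i)).1 h1 i
  simp [pointAttr] at h2

/-- Two different point attributes do not take the value `1` simultaneously. -/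
theorem pointSystem_iDim_ne_top : pointSystem.iDim ≠ ⊤ := by
  intro h
  obtain ⟨f, hf, hinj, hx⟩ := InfoSystem.exists_independent_family h 2
  obtain ⟨a : ℕ+, ha⟩ := hx fun _ => true
  obtain ⟨i, hi⟩ := hf 0
  obtain ⟨j, hj⟩ := hf 1
  have h0 := ha 0
  have h1 := ha 1
  rw [← hi] at h0
  rw [← hj] at h1
  have h0 : a = i := of_decide_eq_true h0
  have h1 : a = j := of_decide_eq_true h1
  have h01 : f 0 = f 1 := by rw [← hi, ← hj, ← h0, ← h1]
  exact absurd (hinj h01) (by decide)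

/-- Assign different objects to the vectors in `{0, 1}^n`; the coordinates of the assigned vectors
are `n` independent attributes. -/
theorem allSystem_iDim : allSystem.iDim = ⊤ := by
  refine ENat.eq_top_iff_forall_ge.2 fun n => ?_
  let e : (Fin n → Bool) → ℕ+ := fun v => Nat.succPNat (Encodable.encode v)
  have he : Function.Injective e := Nat.succPNat_injective.comp Encodable.encode_injective
  have := InfoSystem.card_le_iDim (U := allSystem) (s := (Finset.univ : Finset (Fin n)))
    (f := fun i j => Function.invFun e j i) (fun _ _ => Set.mem_univ _)
    fun v => ⟨e v, fun i _ => congrFun (Function.leftInverse_invFun he v) i⟩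
  simpa using this

theorem theorem1 :
    (∀ U : InfoSystem.{u},
      (∃! t : LocalType, U.HasLocalType t) ∧
      (U.HasLocalType row1 ∨ U.HasLocalType row2 ∨ U.HasLocalType row3) ∧
      (U.HasLocalType row1 ↔ U.Reduction) ∧
      (U.HasLocalType row2 ↔ ¬ U.Reduction ∧ U.iDim ≠ ⊤) ∧
      (U.HasLocalType row3 ↔ U.iDim = ⊤)) ∧
    thresholdSystem.HasLocalType row1 ∧
    pointSystem.HasLocalType row2 ∧
    allSystem.HasLocalType row3 := by
  refine ⟨fun U => ?_, InfoSystem.hasLocalType_row1 thresholdSystem_reduction,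
    InfoSystem.hasLocalType_row2 not_pointSystem_reduction pointSystem_iDim_ne_top,
    InfoSystem.hasLocalType_row3 allSystem_iDim⟩
  have h12 : row1 ≠ row2 := by simp [row1, row2]
  have h13 : row1 ≠ row3 := by simp [row1, row3]
  have h23 : row2 ≠ row3 := by simp [row2, row3]
  have hunique : ∀ {t}, U.HasLocalType t → ∃! t, U.HasLocalType t :=
    fun ht => ⟨_, ht, fun _ hs => hs.unique ht⟩
  by_cases hr : U.Reduction
  · have ht := InfoSystem.hasLocalType_row1 hr
    have hi := InfoSystem.iDim_ne_top_of_reduction hr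
    exact ⟨hunique ht, Or.inl ht, iff_of_true ht hr,
      iff_of_false (fun h => h12 (ht.unique h)) fun h => h.1 hr,
      iff_of_false (fun h => h13 (ht.unique h)) hi⟩
  · by_cases hi : U.iDim = ⊤
    · have ht := InfoSystem.hasLocalType_row3 hi
      exact ⟨hunique ht, Or.inr (Or.inr ht), iff_of_false (fun h => h13 (h.unique ht)) hr,
        iff_of_false (fun h => h23 (h.unique ht)) fun h => h.2 hi, iff_of_true ht hi⟩
    · have ht := InfoSystem.hasLocalType_row2 hr hi
      exact ⟨hunique ht, Or.inr (Or.inl ht), iff_of_false (fun h => h12 (h.unique ht)) hr,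
        iff_of_true ht ⟨hr, hi⟩, iff_of_false (fun h => h23 (ht.unique h)) hi⟩
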